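/- Call a straight-line drawing of a finite simple graph in the plane (vertices at distinct points, edges as closed segments, no edge passing through a vertex other than its endpoints) *plane* if any two edges meet only in a common endpoint. The *slope* of an edge is the angle in $[0,\pi)$ swept anticlockwise from the $x$-axis to the line through it, and the number of slopes of a drawing is the number of distinct slopes of its edges. The faces of a plane drawing are the connected components of the complement of the drawing, and the outerface is the unbounded one. A *planar triangulation* is a graph having a plane drawing in which every face, including the outerface, is bounded by a $3$-cycle. For every $n \ge 4$ there is an $n$-vertex planar triangulation $G_n$ such that every plane drawing of $G_n$ has at least $n+2$ slopes. Moreover, for a particular choice of outerface, that is, for some $3$-cycle $abc$ of $G_n$ that bounds the outerface in a plane drawing of $G_n$ with all faces bounded by $3$-cycles, every plane drawing of $G_n$ whose outerface is bounded by $abc$ has at least $2n-2$ slopes. -/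

import Mathlib

/-- The slope of the line through two distinct points `p`, `q` of the plane: the angle in `[0, π)`
swept anticlockwise from the `x`-axis to that line, i.e. the argument of `q - p` modulo `π`. -/
noncomputable def lineSlope (p q : ℝ × ℝ) : ℝ :=
  toIcoMod Real.pi_pos 0 (Complex.arg ⟨q.1 - p.1, q.2 - p.2⟩)

/-- A straight-line drawing of a graph `G`: the vertices are mapped to distinct points of the plane,
every edge is represented by the closed segment between its endpoints, and the only vertices
that an edge meets are its own endpoints. -/
structure Drawing {V : Type*} (G : SimpleGraph V) where
  pos : V → ℝ × ℝ
  pos_injective : Function.Injective pos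
  vertex_of_mem_edge : ∀ ⦃a b w : V⦄, G.Adj a b → pos w ∈ segment ℝ (pos a) (pos b) →
    w = a ∨ w = b

namespace Drawing

variable {V : Type*} {G : SimpleGraph V}

/-- A drawing is plane if it has no crossings: any point lying on two different edges is a
common endpoint of them. -/
def IsPlane (D : Drawing G) : Prop :=
  ∀ ⦃a b c d : V⦄, G.Adj a b → G.Adj c d → s(a, b) ≠ s(c, d) →
    ∀ p ∈ segment ℝ (D.pos a) (D.pos b) ∩ segment ℝ (D.pos c) (D.pos d),
      ∃ w : V, (w = a ∨ w = b) ∧ (w = c ∨ w = d) ∧ p = D.pos w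

/-- The set of slopes of the edges of the drawing. -/
def slopes (D : Drawing G) : Set ℝ :=
  {s | ∃ a b : V, G.Adj a b ∧ s = lineSlope (D.pos a) (D.pos b)}

/-- The number of slopes of the drawing (the set of slopes is finite for a finite graph). -/
noncomputable def numSlopes (D : Drawing G) : ℕ := D.slopes.ncard

/-- The set of all points of the plane that are covered by the drawing. -/
def support (D : Drawing G) : Set (ℝ × ℝ) :=
  Set.range D.pos ∪ {p | ∃ a b : V, G.Adj a b ∧ p ∈ segment ℝ (D.pos a) (D.pos b)}

/-- The faces of the drawing: the connected components of the complement of its support. -/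
def IsFace (D : Drawing G) (F : Set (ℝ × ℝ)) : Prop :=
  ∃ p ∈ D.supportᶜ, F = connectedComponentIn D.supportᶜ p

/-- The outerface is the unbounded face. -/
def IsOuterface (D : Drawing G) (F : Set (ℝ × ℝ)) : Prop :=
  D.IsFace F ∧ ¬ Bornology.IsBounded F

/-- The boundary of the region `F` is the drawing of the 3-cycle `abc` of `G`. -/
def IsBoundedByTriangle (D : Drawing G) (F : Set (ℝ × ℝ)) (a b c : V) : Prop :=
  G.Adj a b ∧ G.Adj b c ∧ G.Adj c a ∧
    frontier F = segment ℝ (D.pos a) (D.pos b) ∪ segment ℝ (D.pos b) (D.pos c) ∪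
      segment ℝ (D.pos c) (D.pos a)

/-- A plane drawing all of whose faces, including the outerface, are bounded by 3-cycles. -/
def IsTriangulated (D : Drawing G) : Prop :=
  D.IsPlane ∧ ∀ F, D.IsFace F → ∃ a b c : V, D.IsBoundedByTriangle F a b c

/-- The outerface of the drawing is bounded by the 3-cycle `abc`. -/
def HasOuterface (D : Drawing G) (a b c : V) : Prop :=
  ∃ F, D.IsOuterface F ∧ D.IsBoundedByTriangle F a b c

end Drawing

/-- A planar triangulation: a graph that can be drawn in the plane without crossings so that every
face, including the outerface, is bounded by a 3-cycle. -/
def IsPlanarTriangulation {V : Type*} (G : SimpleGraph V) : Prop :=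
  ∃ D : Drawing G, D.IsTriangulated

open Set Topology

/-! The witness is the join of an edge `01` with a path on the remaining vertices, so that `0` and
`1` are adjacent to everything.

Every plane drawing of it lies inside a triangle `xyz` of the graph with `x` one of `0`, `1`
(`exists_triangle`). All edges at `x` then lie in a cone of angle less than π, so two of equal slope
would lie on one ray and the longer would pass through a vertex. This gives `n - 1` slopes at `x`
(`lineSlope_injOn`). In the affine frame at `x` with axes towards `y` and `z`, these directions have
nonnegative coordinates. If `w` is a further common neighbour of `y` and `z`, it lies strictly
inside the triangle, so the edges `yz`, `yw`, `zw` have coordinates of mixed sign and are pairwise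
nonparallel. The total is `n + 2` (`card_add_two_le`).

If the outerface is `0, 1, n - 1`, the enclosing triangle must be that one (`of_hasOuterface`), so
both `x` and `y` are dominating. The edges at `x` give `n - 1` slopes, those at `y` other than `xy`
give `n - 2` new ones, and an edge from `z` into the interior gives one more
(`two_mul_card_sub_two_le`).

An explicit drawing with the path on the `y`-axis shows that the graph is a triangulation with this
outerface. -/

/-- The cross product of two vectors of the plane. -/
def cross (u v : ℝ × ℝ) : ℝ := u.1 * v.2 - u.2 * v.1

/-- The two arguments differ by an integer multiple of π, and the cross product is the product of
the lengths times the sine of that difference. -/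
theorem cross_eq_zero_of_lineSlope_eq {p q r s : ℝ × ℝ} (h : lineSlope p q = lineSlope r s) :
    cross (q - p) (s - r) = 0 := by
  unfold lineSlope at h
  obtain ⟨m, k, hmk⟩ := (toIcoMod_inj Real.pi_pos (c := 0)).1 h
  set z : ℂ := ⟨q.1 - p.1, q.2 - p.2⟩ with hz
  set w : ℂ := ⟨s.1 - r.1, s.2 - r.2⟩ with hw
  have key : Real.sin (w.arg - z.arg) = 0 := by
    rw [nsmul_eq_mul, nsmul_eq_mul] at hmk
    rw [show w.arg - z.arg = ((m - k : ℤ) : ℝ) * Real.pi by push_cast; linear_combination -hmk]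
    exact Real.sin_int_mul_pi _
  have e1 := Complex.norm_mul_cos_arg z
  have e2 := Complex.norm_mul_sin_arg z
  have e3 := Complex.norm_mul_cos_arg w
  have e4 := Complex.norm_mul_sin_arg w
  have : cross (q - p) (s - r) = z.re * w.im - z.im * w.re := by
    simp [cross, hz, hw]
  rw [this, ← e1, ← e2, ← e3, ← e4]
  rw [Real.sin_sub] at key
  linear_combination ‖z‖ * ‖w‖ * key

/-! ### Affine coordinates and the topology of a triangle -/

/-- The first affine coordinate of `p` in the frame with origin `u` and axes `v - u`, `w - u`. -/
noncomputable def coordS (u v w p : ℝ × ℝ) : ℝ := cross (p - u) (w - u) / cross (v - u) (w - u)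

/-- The second affine coordinate of `p` in the frame with origin `u` and axes `v - u`, `w - u`. -/
noncomputable def coordT (u v w p : ℝ × ℝ) : ℝ := cross (v - u) (p - u) / cross (v - u) (w - u)

section Triangle

variable {u v w : ℝ × ℝ}

theorem eq_coord (h : cross (v - u) (w - u) ≠ 0) (p : ℝ × ℝ) :
    p = u + coordS u v w p • (v - u) + coordT u v w p • (w - u) := by
  ext <;> simp only [coordS, coordT, Prod.fst_add, Prod.snd_add, Prod.smul_fst, Prod.smul_snd,
    smul_eq_mul, Prod.fst_sub, Prod.snd_sub] <;> field_simp <;>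
    simp only [cross, Prod.fst_sub, Prod.snd_sub] <;> ring

theorem coordS_frame (h : cross (v - u) (w - u) ≠ 0) (s t : ℝ) :
    coordS u v w (u + s • (v - u) + t • (w - u)) = s := by
  rw [coordS, div_eq_iff h]
  simp [cross]; ring

theorem coordT_frame (h : cross (v - u) (w - u) ≠ 0) (s t : ℝ) :
    coordT u v w (u + s • (v - u) + t • (w - u)) = t := by
  rw [coordT, div_eq_iff h]
  simp [cross]; ring

theorem coordS_combo {a b : ℝ} (hab : a + b = 1) (p q : ℝ × ℝ) :
    coordS u v w (a • p + b • q) = a * coordS u v w p + b * coordS u v w q := by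
  obtain rfl : b = 1 - a := by linarith
  simp only [coordS, cross, Prod.fst_add, Prod.snd_add, Prod.smul_fst, Prod.smul_snd,
    smul_eq_mul, Prod.fst_sub, Prod.snd_sub]
  ring

theorem coordT_combo {a b : ℝ} (hab : a + b = 1) (p q : ℝ × ℝ) :
    coordT u v w (a • p + b • q) = a * coordT u v w p + b * coordT u v w q := by
  obtain rfl : b = 1 - a := by linarith
  simp only [coordT, cross, Prod.fst_add, Prod.snd_add, Prod.smul_fst, Prod.smul_snd,
    smul_eq_mul, Prod.fst_sub, Prod.snd_sub]
  ring

theorem continuous_coordS : Continuous (coordS u v w) := by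
  unfold coordS cross; fun_prop

theorem continuous_coordT : Continuous (coordT u v w) := by
  unfold coordT cross; fun_prop

theorem mem_triangle_iff_exists (p : ℝ × ℝ) : p ∈ convexHull ℝ {u, v, w} ↔
    ∃ s t : ℝ, 0 ≤ s ∧ 0 ≤ t ∧ s + t ≤ 1 ∧ p = u + s • (v - u) + t • (w - u) := by
  constructor
  · intro hp
    refine convexHull_min (t := {p | ∃ s t : ℝ, 0 ≤ s ∧ 0 ≤ t ∧ s + t ≤ 1 ∧
      p = u + s • (v - u) + t • (w - u)}) ?_ ?_ hp
    · rintro q (rfl | rfl | rfl)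
      · exact ⟨0, 0, by simp⟩
      · exact ⟨1, 0, by simp⟩
      · exact ⟨0, 1, by simp⟩
    · rintro _ ⟨s, t, hs, ht, hst, rfl⟩ _ ⟨s', t', hs', ht', hst', rfl⟩ a b ha hb hab
      refine ⟨a * s + b * s', a * t + b * t', by positivity, by positivity, ?_, ?_⟩
      · nlinarith
      · obtain rfl : b = 1 - a := by linarith
        module
  · rintro ⟨s, t, hs, ht, hst, rfl⟩
    have hc := convex_convexHull ℝ ({u, v, w} : Set (ℝ × ℝ))
    have hu : u ∈ convexHull ℝ ({u, v, w} : Set (ℝ × ℝ)) := subset_convexHull _ _ (by simp)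
    have hv : v ∈ convexHull ℝ ({u, v, w} : Set (ℝ × ℝ)) := subset_convexHull _ _ (by simp)
    have hw : w ∈ convexHull ℝ ({u, v, w} : Set (ℝ × ℝ)) := subset_convexHull _ _ (by simp)
    have := hc.sum_mem (t := Finset.univ) (w := ![1 - s - t, s, t]) (z := ![u, v, w])
      (by intro i _; fin_cases i <;> simp <;> linarith) (by simp [Fin.sum_univ_three]; ring)
      (by intro i _; fin_cases i <;> simpa)
    convert this using 1
    simp [Fin.sum_univ_three]
    module

theorem mem_triangle (h : cross (v - u) (w - u) ≠ 0) (p : ℝ × ℝ) :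
    p ∈ convexHull ℝ {u, v, w} ↔
      0 ≤ coordS u v w p ∧ 0 ≤ coordT u v w p ∧ coordS u v w p + coordT u v w p ≤ 1 := by
  rw [mem_triangle_iff_exists]
  constructor
  · rintro ⟨s, t, hs, ht, hst, rfl⟩
    rw [coordS_frame h, coordT_frame h]
    exact ⟨hs, ht, hst⟩
  · rintro ⟨hs, ht, hst⟩
    exact ⟨_, _, hs, ht, hst, eq_coord h p⟩

/-- The interior of the triangle `uvw`. -/
def openTriangle (u v w : ℝ × ℝ) : Set (ℝ × ℝ) :=
  {p | 0 < coordS u v w p ∧ 0 < coordT u v w p ∧ coordS u v w p + coordT u v w p < 1}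

theorem isOpen_openTriangle : IsOpen (openTriangle u v w) :=
  ((isOpen_lt continuous_const continuous_coordS).inter
    ((isOpen_lt continuous_const continuous_coordT).inter
      (isOpen_lt (continuous_coordS.add continuous_coordT) continuous_const)))

theorem openTriangle_subset (h : cross (v - u) (w - u) ≠ 0) :
    openTriangle u v w ⊆ convexHull ℝ {u, v, w} :=
  fun p hp => (mem_triangle h p).2 ⟨hp.1.le, hp.2.1.le, hp.2.2.le⟩

theorem combo_mem_openTriangle (h : cross (v - u) (w - u) ≠ 0) {p q : ℝ × ℝ}
    (hp : p ∈ openTriangle u v w) (hq : q ∈ convexHull ℝ {u, v, w}) {a b : ℝ}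
    (ha : 0 < a) (hb : 0 ≤ b) (hab : a + b = 1) : a • p + b • q ∈ openTriangle u v w := by
  obtain ⟨p1, p2, p3⟩ := hp
  obtain ⟨q1, q2, q3⟩ := (mem_triangle h q).1 hq
  refine ⟨?_, ?_, ?_⟩
  · rw [coordS_combo hab]; positivity
  · rw [coordT_combo hab]; positivity
  · rw [coordS_combo hab, coordT_combo hab]; nlinarith

theorem convex_openTriangle (h : cross (v - u) (w - u) ≠ 0) : Convex ℝ (openTriangle u v w) := by
  intro p hp q hq a b ha hb hab
  rcases ha.eq_or_lt with rfl | ha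
  · obtain rfl : b = 1 := by linarith
    simpa using hq
  · exact combo_mem_openTriangle h hp (openTriangle_subset h hq) ha hb hab

theorem openTriangle_nonempty (h : cross (v - u) (w - u) ≠ 0) : (openTriangle u v w).Nonempty :=
  ⟨u + (1 / 3 : ℝ) • (v - u) + (1 / 3 : ℝ) • (w - u), by
    simp only [openTriangle, mem_ofPred_eq, coordS_frame h, coordT_frame h]; norm_num⟩

theorem isClosed_triangle (u v w : ℝ × ℝ) : IsClosed (convexHull ℝ {u, v, w}) :=
  (Set.toFinite _).isClosed_convexHull ℝ

/-- The open segment from an interior point to any point of the triangle stays in the open triangle,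
so that point is a limit of interior ones. -/
theorem closure_openTriangle (h : cross (v - u) (w - u) ≠ 0) :
    closure (openTriangle u v w) = convexHull ℝ {u, v, w} := by
  refine (closure_minimal (openTriangle_subset h) (isClosed_triangle u v w)).antisymm ?_
  intro p hp
  obtain ⟨g, hg⟩ := openTriangle_nonempty h
  have : openSegment ℝ g p ⊆ openTriangle u v w := by
    rintro _ ⟨a, b, ha, hb, hab, rfl⟩
    exact combo_mem_openTriangle h hg hp ha hb.le hab
  apply closure_mono this
  rw [closure_openSegment]
  exact right_mem_segment ℝ g p

theorem interior_triangle (h : cross (v - u) (w - u) ≠ 0) :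
    interior (convexHull ℝ {u, v, w}) = openTriangle u v w := by
  rw [← closure_openTriangle h, (convex_openTriangle h).interior_closure_eq_interior_of_nonempty_interior,
    isOpen_openTriangle.interior_eq]
  rw [isOpen_openTriangle.interior_eq]
  exact openTriangle_nonempty h

/-- The union of the sides of the triangle `uvw`. -/
def sides (u v w : ℝ × ℝ) : Set (ℝ × ℝ) := segment ℝ u v ∪ segment ℝ v w ∪ segment ℝ w u

theorem triangle_diff_openTriangle (h : cross (v - u) (w - u) ≠ 0) :
    convexHull ℝ {u, v, w} \ openTriangle u v w = sides u v w := by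
  ext p
  constructor
  · rintro ⟨hp, hn⟩
    obtain ⟨h1, h2, h3⟩ := (mem_triangle h p).1 hp
    have e := eq_coord h p
    by_cases hS : coordS u v w p = 0
    · rw [hS] at e h3
      refine Or.inr ⟨coordT u v w p, 1 - coordT u v w p, h2, by linarith, by ring, ?_⟩
      nth_rw 3 [e]; module
    by_cases hT : coordT u v w p = 0
    · rw [hT] at e h3
      refine Or.inl (Or.inl ⟨1 - coordS u v w p, coordS u v w p, by linarith, h1, by ring, ?_⟩)
      nth_rw 3 [e]; module
    · have hST : coordS u v w p + coordT u v w p = 1 := by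
        by_contra hne
        exact hn ⟨lt_of_le_of_ne h1 (Ne.symm hS), lt_of_le_of_ne h2 (Ne.symm hT),
          lt_of_le_of_ne h3 hne⟩
      refine Or.inl (Or.inr ⟨coordS u v w p, coordT u v w p, h1, h2, hST, ?_⟩)
      nth_rw 3 [e]
      rw [show coordT u v w p = 1 - coordS u v w p by linarith]
      module
  · intro hp
    have aux : ∀ s t : ℝ, 0 ≤ s → 0 ≤ t → s + t ≤ 1 → (s = 0 ∨ t = 0 ∨ s + t = 1) →
        p = u + s • (v - u) + t • (w - u) → p ∈ convexHull ℝ {u, v, w} \ openTriangle u v w := by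
      rintro s t hs ht hst hc rfl
      refine ⟨(mem_triangle_iff_exists _).2 ⟨s, t, hs, ht, hst, rfl⟩, ?_⟩
      rintro ⟨h1, h2, h3⟩
      rw [coordS_frame h, coordT_frame h] at h3
      rw [coordS_frame h] at h1
      rw [coordT_frame h] at h2
      rcases hc with hc | hc | hc <;> linarith
    rcases hp with (⟨a, b, ha, hb, hab, rfl⟩ | ⟨a, b, ha, hb, hab, rfl⟩) | ⟨a, b, ha, hb, hab, rfl⟩
    · exact aux b 0 hb le_rfl (by linarith) (by simp)
        (by rw [show a = 1 - b by linarith]; module)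
    · exact aux a b ha hb hab.le (by simp [hab])
        (by rw [show a = 1 - b by linarith]; module)
    · exact aux 0 a le_rfl ha (by linarith) (by simp)
        (by rw [show b = 1 - a by linarith]; module)

theorem frontier_openTriangle (h : cross (v - u) (w - u) ≠ 0) :
    frontier (openTriangle u v w) = sides u v w := by
  rw [frontier, closure_openTriangle h, isOpen_openTriangle.interior_eq,
    triangle_diff_openTriangle h]

theorem frontier_triangle (h : cross (v - u) (w - u) ≠ 0) :
    frontier (convexHull ℝ {u, v, w}) = sides u v w := by
  rw [frontier, (isClosed_triangle u v w).closure_eq, interior_triangle h,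
    triangle_diff_openTriangle h]

/-- The complement is a union of three open half-planes, each convex, which overlap enough to be
chained together. -/
theorem isPreconnected_compl_triangle (h : cross (v - u) (w - u) ≠ 0) :
    IsPreconnected (convexHull ℝ {u, v, w})ᶜ := by
  have e : (convexHull ℝ {u, v, w})ᶜ = ({p | coordS u v w p < 0} ∪ {p | coordT u v w p < 0}) ∪
      {p | 1 < coordS u v w p + coordT u v w p} := by
    ext p
    simp only [mem_compl_iff, mem_triangle h, mem_union, mem_ofPred_eq]
    constructor
    · intro hn
      by_contra hc
      push Not at hc
      exact hn ⟨hc.1.1, hc.1.2, hc.2⟩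
    · rintro ((h1 | h1) | h1) ⟨h2, h3, h4⟩ <;> linarith
  rw [e]
  have c1 : IsPreconnected {p | coordS u v w p < 0} := by
    refine Convex.isPreconnected fun p hp q hq a b ha hb hab => ?_
    rw [mem_ofPred_eq, coordS_combo hab]
    exact convex_Iio (𝕜 := ℝ) (0 : ℝ) hp hq ha hb hab
  have c2 : IsPreconnected {p | coordT u v w p < 0} := by
    refine Convex.isPreconnected fun p hp q hq a b ha hb hab => ?_
    rw [mem_ofPred_eq, coordT_combo hab]
    exact convex_Iio (𝕜 := ℝ) (0 : ℝ) hp hq ha hb hab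
  have c3 : IsPreconnected {p | 1 < coordS u v w p + coordT u v w p} := by
    refine Convex.isPreconnected fun p hp q hq a b ha hb hab => ?_
    rw [mem_ofPred_eq, coordS_combo hab, coordT_combo hab, add_add_add_comm, ← mul_add, ← mul_add]
    exact convex_Ioi (𝕜 := ℝ) (1 : ℝ) hp hq ha hb hab
  -- The point with coordinates `(-1, -1)` links the first two half-planes, and `(-1, 3)` links the
  -- first to the third.
  refine IsPreconnected.union (u + (-1 : ℝ) • (v - u) + (3 : ℝ) • (w - u)) (Or.inl ?_) ?_
    (IsPreconnected.union (u + (-1 : ℝ) • (v - u) + (-1 : ℝ) • (w - u)) ?_ ?_ c1 c2) c3 <;>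
  · simp only [mem_ofPred_eq, coordS_frame h, coordT_frame h]
    norm_num

theorem frontier_compl_triangle (h : cross (v - u) (w - u) ≠ 0) :
    frontier (convexHull ℝ {u, v, w})ᶜ = sides u v w := by
  rw [frontier_compl, frontier_triangle h]

theorem isBounded_triangle (u v w : ℝ × ℝ) : Bornology.IsBounded (convexHull ℝ {u, v, w}) :=
  (isBounded_convexHull).2 (Set.toFinite _).isBounded

end Triangle

/-! ### Frontiers and connected components -/

/-- If `C` missed the frontier, the interior of `R` and the complement of its closure would separate
`C`. -/
theorem IsPreconnected.inter_frontier_nonempty {X : Type*} [TopologicalSpace X] {C R : Set X}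
    (hC : IsPreconnected C) (h : (C ∩ R).Nonempty) (h' : (C ∩ Rᶜ).Nonempty) :
    (C ∩ frontier R).Nonempty := by
  by_contra hn
  have hfr : ∀ x ∈ C, x ∈ closure R → x ∈ interior R := fun x hx hx' => by
    by_contra hi
    exact hn ⟨x, hx, hx', hi⟩
  obtain ⟨x, hx, hxR⟩ := h
  obtain ⟨y, hy, hyR⟩ := h'
  obtain ⟨z, -, hz1, hz2⟩ := hC (interior R) (closure R)ᶜ isOpen_interior
    isClosed_closure.isOpen_compl
    (fun z hz => (em (z ∈ closure R)).imp (hfr z hz) id)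
    ⟨x, hx, hfr x hx (subset_closure hxR)⟩
    ⟨y, hy, fun hc => hyR (interior_subset (hfr y hy hc))⟩
  exact hz2 (subset_closure (interior_subset hz1))

/-- A preconnected subset of `A` whose frontier avoids `A` is a connected component of `A`. -/
theorem connectedComponentIn_eq_of_frontier {X : Type*} [TopologicalSpace X] {A R : Set X} {p : X}
    (hR : IsPreconnected R) (hRA : R ⊆ A) (hfr : Disjoint (frontier R) A) (hp : p ∈ R) :
    connectedComponentIn A p = R := by
  refine Subset.antisymm ?_ (hR.subset_connectedComponentIn hp hRA)
  by_contra hn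
  obtain ⟨q, hq, hqR⟩ := not_subset.1 hn
  obtain ⟨r, hr, hr'⟩ := isPreconnected_connectedComponentIn.inter_frontier_nonempty (R := R)
    ⟨p, mem_connectedComponentIn (hRA hp), hp⟩ ⟨q, hq, hqR⟩
  exact hfr.le_bot ⟨hr', connectedComponentIn_subset _ _ hr⟩

theorem combo_mem_triangle {u v w : ℝ × ℝ} {a b c : ℝ} (ha : 0 ≤ a) (hb : 0 ≤ b) (hc : 0 ≤ c)
    (habc : a + b + c = 1) : a • u + b • v + c • w ∈ convexHull ℝ {u, v, w} := by
  refine (mem_triangle_iff_exists _).2 ⟨b, c, hb, hc, by linarith, ?_⟩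
  obtain rfl : a = 1 - b - c := by linarith
  module

theorem coordS_origin (u v w : ℝ × ℝ) : coordS u v w u = 0 := by simp [coordS, cross]

theorem coordT_origin (u v w : ℝ × ℝ) : coordT u v w u = 0 := by simp [coordT, cross]

theorem coordS_fst {u v w : ℝ × ℝ} (h : cross (v - u) (w - u) ≠ 0) : coordS u v w v = 1 :=
  div_self h

theorem coordT_fst (u v w : ℝ × ℝ) : coordT u v w v = 0 := by
  simp [coordT, cross, mul_comm]

theorem coordS_snd (u v w : ℝ × ℝ) : coordS u v w w = 0 := by
  simp [coordS, cross, mul_comm]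

theorem coordT_snd {u v w : ℝ × ℝ} (h : cross (v - u) (w - u) ≠ 0) : coordT u v w w = 1 :=
  div_self h

/-- An affine change of frame scales all cross products by one determinant, so parallelism can be
read off in the frame, where sign considerations rule it out. -/
theorem coord_of_lineSlope_eq {u v w p q r s : ℝ × ℝ} (h : cross (v - u) (w - u) ≠ 0)
    (hs : lineSlope p q = lineSlope r s) :
    (coordS u v w q - coordS u v w p) * (coordT u v w s - coordT u v w r) =
      (coordT u v w q - coordT u v w p) * (coordS u v w s - coordS u v w r) := by
  have key := cross_eq_zero_of_lineSlope_eq hs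
  simp only [coordS, coordT]
  field_simp
  simp only [cross, Prod.fst_sub, Prod.snd_sub] at *
  linear_combination ((v.1 - u.1) * (w.2 - u.2) - (v.2 - u.2) * (w.1 - u.1)) * key

/-! ### Plane drawings and triangles of the graph -/

namespace Drawing

variable {V : Type*} {G : SimpleGraph V} (D : Drawing G)

/-- If three mutually adjacent vertices were collinear, the middle one would lie on the edge joining
the other two. -/
theorem cross_ne_zero {x y z : V} (hxy : G.Adj x y) (hyz : G.Adj y z) (hzx : G.Adj z x) :
    cross (D.pos y - D.pos x) (D.pos z - D.pos x) ≠ 0 := by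
  intro h
  have hne : D.pos y - D.pos x ≠ 0 := sub_ne_zero.2 fun e => hxy.ne (D.pos_injective e).symm
  obtain ⟨c, hc⟩ : ∃ c : ℝ, D.pos z - D.pos x = c • (D.pos y - D.pos x) := by
    set e := D.pos y - D.pos x
    set f := D.pos z - D.pos x
    simp only [cross] at h
    by_cases h1 : e.1 = 0
    · have h2 : e.2 ≠ 0 := fun h2 => hne (Prod.ext h1 h2)
      have h3 : f.1 = 0 := by
        rw [h1, zero_mul, zero_sub, neg_eq_zero] at h
        exact (mul_eq_zero.1 h).resolve_left h2
      exact ⟨f.2 / e.2, Prod.ext (by simp [h1, h3]) (by simp [h2])⟩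
    · refine ⟨f.1 / e.1, Prod.ext (by simp [h1]) ?_⟩
      simp only [Prod.smul_snd, smul_eq_mul]
      field_simp
      linarith
  have hz : D.pos z = D.pos x + c • (D.pos y - D.pos x) := by rw [← hc]; abel
  -- The position of `c` relative to `0` and `1` tells whether `x`, `z` or `y` is the middle point.
  rcases lt_or_ge c 0 with h0 | h0
  · have hd : (1 - c) ≠ 0 := by linarith
    have := D.vertex_of_mem_edge hyz (w := x) ⟨-c / (1 - c), 1 / (1 - c),
      div_nonneg (by linarith) (by linarith), div_nonneg (by linarith) (by linarith),
      by field_simp; ring, by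
        rw [hz]
        ext <;> simp <;> field_simp <;> ring⟩
    rcases this with e | e
    · exact hxy.ne e
    · exact hzx.ne e.symm
  rcases le_or_gt c 1 with h1 | h1
  · have := D.vertex_of_mem_edge hxy (w := z) ⟨1 - c, c, by linarith, h0, by ring, by
      rw [hz]; module⟩
    rcases this with e | e
    · exact hzx.ne e
    · exact hyz.ne e.symm
  · have hd : c ≠ 0 := by linarith
    have := D.vertex_of_mem_edge hzx (w := y) ⟨1 / c, 1 - 1 / c, by positivity, by
      rw [sub_nonneg, div_le_one (by linarith)]; exact h1.le, by ring, by
      rw [hz]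
      ext <;> simp <;> field_simp <;> ring⟩
    rcases this with e | e
    · exact hyz.ne e
    · exact hxy.ne e.symm

theorem vertex_of_mem_sides {x y z w : V} (hxy : G.Adj x y) (hyz : G.Adj y z) (hzx : G.Adj z x)
    (hw : D.pos w ∈ sides (D.pos x) (D.pos y) (D.pos z)) : w = x ∨ w = y ∨ w = z := by
  rcases hw with (hw | hw) | hw
  · have := D.vertex_of_mem_edge hxy hw; tauto
  · have := D.vertex_of_mem_edge hyz hw; tauto
  · have := D.vertex_of_mem_edge hzx hw; tauto

variable {D}

/-- The edge `pv` meets the boundary of the triangle, hence one of its sides. By planarity they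
share an endpoint, and it is not `p`, which is no corner. -/
theorem IsPlane.mem_of_adj_outside (hD : D.IsPlane) {x y z p v : V} (hxy : G.Adj x y)
    (hyz : G.Adj y z) (hzx : G.Adj z x)
    (hp : D.pos p ∉ convexHull ℝ {D.pos x, D.pos y, D.pos z})
    (hv : D.pos v ∈ convexHull ℝ {D.pos x, D.pos y, D.pos z}) (hpv : G.Adj p v) :
    v = x ∨ v = y ∨ v = z := by
  have hpx : p ≠ x := by
    rintro rfl; exact hp (subset_convexHull _ _ (by simp))
  have hpy : p ≠ y := by
    rintro rfl; exact hp (subset_convexHull _ _ (by simp))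
  have hpz : p ≠ z := by
    rintro rfl; exact hp (subset_convexHull _ _ (by simp))
  obtain ⟨q, hq, hq'⟩ := (convex_segment (D.pos p) (D.pos v)).isPreconnected.inter_frontier_nonempty
    (R := convexHull ℝ {D.pos x, D.pos y, D.pos z}) ⟨_, right_mem_segment _ _ _, hv⟩
    ⟨_, left_mem_segment _ _ _, hp⟩
  rw [frontier_triangle (D.cross_ne_zero hxy hyz hzx)] at hq'
  have aux : ∀ a b : V, G.Adj a b → p ≠ a → p ≠ b → q ∈ segment ℝ (D.pos a) (D.pos b) →
      v = a ∨ v = b := by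
    intro a b hab hpa hpb hqab
    have hne : s(p, v) ≠ s(a, b) := by
      intro h
      have := h ▸ Sym2.mem_mk_left p v
      rcases Sym2.mem_iff.1 this with e | e
      · exact hpa e
      · exact hpb e
    obtain ⟨w, h1, h2, -⟩ := hD hpv hab hne q ⟨hq, hqab⟩
    rcases h1 with rfl | rfl
    · tauto
    · exact h2
  rcases hq' with (hq' | hq') | hq'
  · have := aux x y hxy hpx hpy hq'; tauto
  · have := aux y z hyz hpy hpz hq'; tauto
  · have := aux z x hzx hpz hpx hq'; tauto

/-- With only the barycentric coordinate at `a` negative, `p` lies beyond `bc` in the angle at `a`,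
so `pa` would cross `bc`. The crossing point is obtained by moving the `a` term to the left and
dividing by `1 - α`. -/
theorem IsPlane.not_crossing (hD : D.IsPlane) {a b c p : V} (hbc : G.Adj b c) (hpa : G.Adj p a)
    (hab : a ≠ b) (hac : a ≠ c) (hpb : p ≠ b) (hpc : p ≠ c) {α β γ : ℝ} (hs : α + β + γ = 1)
    (h : D.pos p = α • D.pos a + β • D.pos b + γ • D.pos c) (hα : α < 0) (hβ : 0 ≤ β)
    (hγ : 0 ≤ γ) : False := by
  have hd : 0 < 1 - α := by linarith
  have hd' := hd.ne'
  have hne : s(p, a) ≠ s(b, c) := by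
    intro h
    have := h ▸ Sym2.mem_mk_left p a
    rcases Sym2.mem_iff.1 this with e | e
    · exact hpb e
    · exact hpc e
  obtain ⟨w, h1, h2, -⟩ := hD hpa hbc hne
    ((β / (1 - α)) • D.pos b + (γ / (1 - α)) • D.pos c)
    ⟨⟨1 / (1 - α), -α / (1 - α), by positivity, div_nonneg (by linarith) hd.le, by
        field_simp; ring, by
        rw [h]; ext <;> simp <;> field_simp <;> ring⟩,
      ⟨_, _, div_nonneg hβ hd.le, div_nonneg hγ hd.le, by field_simp; linarith, rfl⟩⟩
  rcases h1 with rfl | rfl <;> rcases h2 with rfl | rfl <;> contradiction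

/-- Solving for `w` gives `(p - αu - βv) / γ`, a convex combination. -/
theorem mem_triangle_of_neg {u v w p : ℝ × ℝ} {α β γ : ℝ} (hs : α + β + γ = 1)
    (h : p = α • u + β • v + γ • w) (hα : α ≤ 0) (hβ : β ≤ 0) : w ∈ convexHull ℝ {p, u, v} := by
  have hd : 0 < γ := by linarith
  have hd' := hd.ne'
  have := combo_mem_triangle (u := p) (v := u) (w := v) (a := 1 / γ) (b := -α / γ) (c := -β / γ)
    (by positivity) (div_nonneg (by linarith) hd.le) (div_nonneg (by linarith) hd.le)
    (by field_simp; linarith)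
  convert this using 1
  rw [h]
  ext <;> simp <;> field_simp <;> ring

/-- The signs of the barycentric coordinates of `p` decide: no negative one puts `p` inside, exactly
one forces a crossing, and three contradict the sum being 1. With two negative, the remaining corner
is swallowed by the triangle of `p` and the other two. -/
theorem IsPlane.exists_mem_triangle (hD : D.IsPlane) {a b c p : V} (hab : G.Adj a b)
    (hbc : G.Adj b c) (hca : G.Adj c a) (hpa : G.Adj p a) (hpb : G.Adj p b) (hpc : G.Adj p c)
    (hp : D.pos p ∉ convexHull ℝ {D.pos a, D.pos b, D.pos c}) :
    D.pos a ∈ convexHull ℝ {D.pos p, D.pos b, D.pos c} ∨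
    D.pos b ∈ convexHull ℝ {D.pos p, D.pos c, D.pos a} ∨
    D.pos c ∈ convexHull ℝ {D.pos p, D.pos a, D.pos b} := by
  obtain ⟨α, β, γ, hs, h⟩ : ∃ α β γ : ℝ, α + β + γ = 1 ∧
      D.pos p = α • D.pos a + β • D.pos b + γ • D.pos c := by
    have := eq_coord (D.cross_ne_zero hab hbc hca) (D.pos p)
    exact ⟨1 - coordS (D.pos a) (D.pos b) (D.pos c) (D.pos p) -
      coordT (D.pos a) (D.pos b) (D.pos c) (D.pos p), coordS (D.pos a) (D.pos b) (D.pos c) (D.pos p),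
      coordT (D.pos a) (D.pos b) (D.pos c) (D.pos p), by ring, this.trans (by module)⟩
  have h' : D.pos p = β • D.pos b + γ • D.pos c + α • D.pos a := by rw [h]; abel
  have h'' : D.pos p = γ • D.pos c + α • D.pos a + β • D.pos b := by rw [h]; abel
  rcases lt_or_ge α 0 with hα | hα <;> rcases lt_or_ge β 0 with hβ | hβ <;>
    rcases lt_or_ge γ 0 with hγ | hγ
  · linarith
  · exact Or.inr (Or.inr (mem_triangle_of_neg hs h hα.le hβ.le))
  · exact Or.inr (Or.inl (mem_triangle_of_neg (by linarith) h'' hγ.le hα.le))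
  · exact (hD.not_crossing hbc hpa hab.ne hca.ne' hpb.ne hpc.ne hs h hα hβ hγ).elim
  · exact Or.inl (mem_triangle_of_neg (by linarith) h' hβ.le hγ.le)
  · exact (hD.not_crossing hca hpb hbc.ne hab.ne' hpc.ne hpa.ne (by linarith) h' hβ hγ hα).elim
  · exact (hD.not_crossing hab hpc hca.ne hbc.ne' hpa.ne hpb.ne (by linarith) h'' hγ hα hβ).elim
  · exact (hp (by rw [h]; exact combo_mem_triangle hα hβ hγ hs)).elim

/-! ### Drawings enclosed in a triangle -/

variable (D)

/-- Every vertex of the drawing lies in the triangle spanned by `x`, `y`, `z`. -/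
def Encloses (x y z : V) : Prop :=
  ∀ v, D.pos v ∈ convexHull ℝ {D.pos x, D.pos y, D.pos z}

variable {D}

theorem Encloses.trans {x y z a b c : V} (h : D.Encloses x y z)
    (hx : D.pos x ∈ convexHull ℝ {D.pos a, D.pos b, D.pos c})
    (hy : D.pos y ∈ convexHull ℝ {D.pos a, D.pos b, D.pos c})
    (hz : D.pos z ∈ convexHull ℝ {D.pos a, D.pos b, D.pos c}) : D.Encloses a b c := fun v =>
  convexHull_min (by rintro _ (rfl | rfl | rfl) <;> assumption) (convex_convexHull ℝ _) (h v)

theorem pos_mem_of_eq {x a b c : V} (h : x = a ∨ x = b ∨ x = c) :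
    D.pos x ∈ convexHull ℝ {D.pos a, D.pos b, D.pos c} :=
  subset_convexHull _ _ (by rcases h with rfl | rfl | rfl <;> simp)

theorem Encloses.mem_openTriangle {x y z w : V} (h : D.Encloses x y z) (hxy : G.Adj x y)
    (hyz : G.Adj y z) (hzx : G.Adj z x) (hwx : w ≠ x) (hwy : w ≠ y) (hwz : w ≠ z) :
    D.pos w ∈ openTriangle (D.pos x) (D.pos y) (D.pos z) := by
  by_contra hn
  have : D.pos w ∈ sides (D.pos x) (D.pos y) (D.pos z) := by
    rw [← triangle_diff_openTriangle (D.cross_ne_zero hxy hyz hzx)]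
    exact ⟨h w, hn⟩
  have := D.vertex_of_mem_sides hxy hyz hzx this
  tauto

theorem Encloses.support_subset {x y z : V} (h : D.Encloses x y z) :
    D.support ⊆ convexHull ℝ {D.pos x, D.pos y, D.pos z} := by
  rintro p (⟨v, rfl⟩ | ⟨a, b, -, hp⟩)
  · exact h v
  · exact (convex_convexHull ℝ _).segment_subset (h a) (h b) hp

/-- The connected exterior of `xyz` lies in the outerface. Hence `x`, `y`, `z` are in the closure of
the outerface, and being in the support they are on its frontier, the sides of `abc`. A vertex on
those sides is one of `a`, `b`, `c`. -/
theorem Encloses.of_hasOuterface {x y z a b c : V} (h : D.Encloses x y z) (hxy : G.Adj x y)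
    (hyz : G.Adj y z) (hzx : G.Adj z x) (hO : D.HasOuterface a b c) : D.Encloses a b c := by
  obtain ⟨F, ⟨⟨p, hp, rfl⟩, hF⟩, hab, hbc, hca, hfr⟩ := hO
  have hcr := D.cross_ne_zero hxy hyz hzx
  obtain ⟨q, hq, hqT⟩ : ∃ q ∈ connectedComponentIn D.supportᶜ p,
      q ∉ convexHull ℝ {D.pos x, D.pos y, D.pos z} := by
    by_contra hc
    push Not at hc
    exact hF ((isBounded_triangle _ _ _).subset hc)
  have hsub : (convexHull ℝ {D.pos x, D.pos y, D.pos z})ᶜ ⊆ connectedComponentIn D.supportᶜ p := by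
    rw [connectedComponentIn_eq hq]
    exact (isPreconnected_compl_triangle hcr).subset_connectedComponentIn hqT
      (compl_subset_compl.2 h.support_subset)
  have aux : ∀ w, D.pos w ∈ sides (D.pos x) (D.pos y) (D.pos z) → w = a ∨ w = b ∨ w = c := by
    intro w hw
    refine D.vertex_of_mem_sides hab hbc hca ?_
    rw [sides, ← hfr]
    rw [← frontier_compl_triangle hcr] at hw
    exact ⟨closure_mono hsub hw.1, fun hi =>
      connectedComponentIn_subset _ _ (interior_subset hi) (Or.inl ⟨w, rfl⟩)⟩
  refine h.trans (pos_mem_of_eq (aux x ?_)) (pos_mem_of_eq (aux y ?_)) (pos_mem_of_eq (aux z ?_))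
  · exact Or.inl (Or.inl (left_mem_segment _ _ _))
  · exact Or.inl (Or.inl (right_mem_segment _ _ _))
  · exact Or.inr (left_mem_segment _ _ _)

/-- Seen from a corner, all vertices lie in a cone of angle less than π, so equal slope means equal
ray, and the nearer vertex would lie on the edge to the farther one. -/
theorem Encloses.lineSlope_injOn {x y z : V} (h : D.Encloses x y z) (hxy : G.Adj x y)
    (hyz : G.Adj y z) (hzx : G.Adj z x) (hx : ∀ v, v ≠ x → G.Adj x v) :
    InjOn (fun v => lineSlope (D.pos x) (D.pos v)) {x}ᶜ := by
  intro p hp q hq he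
  have hcr := D.cross_ne_zero hxy hyz hzx
  have key := coord_of_lineSlope_eq hcr he
  rw [coordS_origin, coordT_origin] at key
  simp only [sub_zero] at key
  -- The sum of the two coordinates serves as distance from `x` along a ray; this treats the case
  -- where `p` is the nearer vertex.
  have epq : ∀ p q : V, p ≠ x → q ≠ x →
      coordS (D.pos x) (D.pos y) (D.pos z) (D.pos p) * coordT (D.pos x) (D.pos y) (D.pos z) (D.pos q) =
      coordT (D.pos x) (D.pos y) (D.pos z) (D.pos p) * coordS (D.pos x) (D.pos y) (D.pos z) (D.pos q) →
      coordS (D.pos x) (D.pos y) (D.pos z) (D.pos p) + coordT (D.pos x) (D.pos y) (D.pos z) (D.pos p) ≤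
      coordS (D.pos x) (D.pos y) (D.pos z) (D.pos q) + coordT (D.pos x) (D.pos y) (D.pos z) (D.pos q)
      → p = q := by
    intro p q hp hq key hle
    obtain ⟨p1, p2, -⟩ := (mem_triangle hcr _).1 (h p)
    obtain ⟨q1, q2, -⟩ := (mem_triangle hcr _).1 (h q)
    have ep := eq_coord hcr (D.pos p)
    have eq := eq_coord hcr (D.pos q)
    set S := coordS (D.pos x) (D.pos y) (D.pos z) (D.pos p)
    set T := coordT (D.pos x) (D.pos y) (D.pos z) (D.pos p)
    set S' := coordS (D.pos x) (D.pos y) (D.pos z) (D.pos q)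
    set T' := coordT (D.pos x) (D.pos y) (D.pos z) (D.pos q)
    have hpos : 0 < S' + T' := by
      refine lt_of_le_of_ne (by linarith) fun h0 => hq (D.pos_injective ?_)
      rw [eq, show S' = 0 by linarith, show T' = 0 by linarith]
      simp
    have hpos' := hpos.ne'
    obtain ⟨c, hc0, hc1, hS, hT⟩ : ∃ c : ℝ, 0 ≤ c ∧ c ≤ 1 ∧ S = c * S' ∧ T = c * T' :=
      ⟨(S + T) / (S' + T'), by positivity, (div_le_one hpos).2 hle,
        by field_simp; linear_combination key, by field_simp; linear_combination -key⟩
    have := D.vertex_of_mem_edge (hx q hq) (w := p) ⟨1 - c, c, by linarith, hc0, by ring, by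
      rw [ep, eq, hS, hT]
      module⟩
    exact this.resolve_left hp
  rcases le_total (coordS (D.pos x) (D.pos y) (D.pos z) (D.pos p) +
    coordT (D.pos x) (D.pos y) (D.pos z) (D.pos p)) (coordS (D.pos x) (D.pos y) (D.pos z) (D.pos q) +
    coordT (D.pos x) (D.pos y) (D.pos z) (D.pos q)) with hle | hle
  · exact epq p q hp hq key hle
  · exact (epq q p hq hp (by linarith) hle).symm

theorem card_le_numSlopes [Finite V] {ι : Type*} [Fintype ι] (f : ι → ℝ)
    (hf : Function.Injective f) (hD : ∀ i, f i ∈ D.slopes) : Fintype.card ι ≤ D.numSlopes := by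
  have hfin : D.slopes.Finite := by
    refine (Set.finite_range fun e : V × V => lineSlope (D.pos e.1) (D.pos e.2)).subset ?_
    rintro _ ⟨a, b, -, rfl⟩
    exact ⟨(a, b), rfl⟩
  rw [numSlopes, ← Nat.card_eq_fintype_card, ← Set.ncard_range_of_injective hf]
  exact Set.ncard_le_ncard (Set.range_subset_iff.2 hD) hfin

end Drawing

/-! ### Counting slopes -/

namespace Drawing

variable {V : Type*} {G : SimpleGraph V} {D : Drawing G}

theorem Encloses.coord_pos {x y z : V} (h : D.Encloses x y z)
    (hcr : cross (D.pos y - D.pos x) (D.pos z - D.pos x) ≠ 0) {v : V} (hv : v ≠ x) :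
    0 < coordS (D.pos x) (D.pos y) (D.pos z) (D.pos v) +
      coordT (D.pos x) (D.pos y) (D.pos z) (D.pos v) := by
  obtain ⟨h1, h2, -⟩ := (mem_triangle hcr _).1 (h v)
  refine lt_of_le_of_ne (by linarith) fun h0 => hv (D.pos_injective ?_)
  rw [eq_coord hcr (D.pos v),
    show coordS (D.pos x) (D.pos y) (D.pos z) (D.pos v) = 0 by linarith,
    show coordT (D.pos x) (D.pos y) (D.pos z) (D.pos v) = 0 by linarith]
  simp

/-- In the frame at `x`, edges at `x` have direction `(≥ 0, ≥ 0)`, while `yz`, `yw`, `zw` have mixed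
signs. The latter three are pairwise nonparallel because the interior point `w` is off the line
`yz`. -/
theorem Encloses.card_add_two_le [Fintype V] {x y z w : V} (h : D.Encloses x y z)
    (hyz : G.Adj y z) (hx : ∀ v, v ≠ x → G.Adj x v) (hyx : y ≠ x) (hzx : z ≠ x) (hwx : w ≠ x)
    (hyw : G.Adj y w) (hzw : G.Adj z w) : Fintype.card V + 2 ≤ D.numSlopes := by
  classical
  have hcr := D.cross_ne_zero (hx y hyx) hyz (hx z hzx).symm
  obtain ⟨w1, w2, w3⟩ := h.mem_openTriangle (hx y hyx) hyz (hx z hzx).symm hwx hyw.ne' hzw.ne'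
  let f : {v // v ≠ x} → ℝ := fun v => lineSlope (D.pos x) (D.pos v)
  let g : Fin 3 → ℝ := ![lineSlope (D.pos y) (D.pos z), lineSlope (D.pos y) (D.pos w),
    lineSlope (D.pos z) (D.pos w)]
  have hf : Function.Injective f := fun p q hpq =>
    Subtype.ext (h.lineSlope_injOn (hx y hyx) hyz (hx z hzx).symm hx p.2 q.2 hpq)
  have e1 : lineSlope (D.pos y) (D.pos z) ≠ lineSlope (D.pos y) (D.pos w) := fun e => by
    have := coord_of_lineSlope_eq hcr e
    rw [coordS_fst hcr, coordT_fst, coordS_snd, coordT_snd hcr] at this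
    linarith
  have e2 : lineSlope (D.pos y) (D.pos z) ≠ lineSlope (D.pos z) (D.pos w) := fun e => by
    have := coord_of_lineSlope_eq hcr e
    rw [coordS_fst hcr, coordT_fst, coordS_snd, coordT_snd hcr] at this
    linarith
  have e3 : lineSlope (D.pos y) (D.pos w) ≠ lineSlope (D.pos z) (D.pos w) := fun e => by
    have := coord_of_lineSlope_eq hcr e
    rw [coordS_fst hcr, coordT_fst, coordS_snd, coordT_snd hcr] at this
    linarith
  have hg : Function.Injective g := by
    intro i j hij
    fin_cases i <;> fin_cases j <;> simp [g] at hij ⊢ <;>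
      first
      | exact e1 hij | exact e2 hij | exact e3 hij | exact e1 hij.symm | exact e2 hij.symm | exact e3 hij.symm
  have hfg : ∀ v i, f v ≠ g i := by
    rintro ⟨v, hv⟩ i e
    have hpos := h.coord_pos hcr hv
    obtain ⟨v1, v2, -⟩ := (mem_triangle hcr _).1 (h v)
    fin_cases i
    · have := coord_of_lineSlope_eq hcr e
      rw [coordS_fst hcr, coordT_fst, coordS_snd, coordT_snd hcr, coordS_origin,
        coordT_origin] at this
      linarith
    · have := coord_of_lineSlope_eq hcr e
      rw [coordS_fst hcr, coordT_fst, coordS_origin, coordT_origin] at this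
      nlinarith
    · have := coord_of_lineSlope_eq hcr e
      rw [coordS_snd, coordT_snd hcr, coordS_origin, coordT_origin] at this
      nlinarith
  have := card_le_numSlopes (D := D) (Sum.elim f g) (hf.sumElim hg hfg) (by
    rintro (⟨v, hv⟩ | i)
    · exact ⟨x, v, hx v hv, rfl⟩
    · fin_cases i
      · exact ⟨y, z, hyz, rfl⟩
      · exact ⟨y, w, hyw, rfl⟩
      · exact ⟨z, w, hzw, rfl⟩)
  have hc : Fintype.card {v // v ≠ x} = Fintype.card V - 1 := by simp
  rw [Fintype.card_sum, Fintype.card_fin, hc] at this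
  have : 0 < Fintype.card V := Fintype.card_pos_iff.2 ⟨x⟩
  omega

/-- In the frame at `x`, edges at `x` have nonnegative direction, and the other edges at `y` and the
edge `zw` have mixed signs. A direction `(S - 1, T)` from `y` is not parallel to `zw`: `1 - S ≥ T >
0` and `w` is strictly below the line `yz`, so the relevant products differ strictly. -/
theorem Encloses.two_mul_card_sub_two_le [Fintype V] {x y z w : V} (h : D.Encloses x y z)
    (hx : ∀ v, v ≠ x → G.Adj x v) (hy : ∀ v, v ≠ y → G.Adj y v) (hyx : y ≠ x) (hzx : z ≠ x)
    (hzy : z ≠ y) (hwx : w ≠ x) (hwy : w ≠ y) (hzw : G.Adj z w) :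
    2 * Fintype.card V - 2 ≤ D.numSlopes := by
  classical
  have hcr := D.cross_ne_zero (hx y hyx) (hy z hzy) (hx z hzx).symm
  obtain ⟨w1, w2, w3⟩ := h.mem_openTriangle (hx y hyx) (hy z hzy) (hx z hzx).symm hwx hwy hzw.ne'
  let f : {v // v ≠ x} → ℝ := fun v => lineSlope (D.pos x) (D.pos v)
  -- The vertex `x` is left out because the edge `xy` is already counted by `f`.
  let g : {v // v ≠ x ∧ v ≠ y} → ℝ := fun v => lineSlope (D.pos y) (D.pos v)
  let k : Unit → ℝ := fun _ => lineSlope (D.pos z) (D.pos w)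
  have hf : Function.Injective f := fun p q hpq =>
    Subtype.ext (h.lineSlope_injOn (hx y hyx) (hy z hzy) (hx z hzx).symm hx p.2 q.2 hpq)
  have h' : D.Encloses y x z := h.trans (pos_mem_of_eq (by simp)) (pos_mem_of_eq (by simp))
    (pos_mem_of_eq (by simp))
  have hg : Function.Injective g := fun p q hpq =>
    Subtype.ext (h'.lineSlope_injOn (hx y hyx).symm (hx z hzx) (hy z hzy).symm hy
      p.2.2 q.2.2 hpq)
  have hk : Function.Injective k := fun _ _ _ => rfl
  have hT : ∀ v, v ≠ x → v ≠ y → 0 < coordT (D.pos x) (D.pos y) (D.pos z) (D.pos v) := by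
    intro v hvx hvy
    by_cases hvz : v = z
    · rw [hvz, coordT_snd hcr]; exact one_pos
    · exact (h.mem_openTriangle (hx y hyx) (hy z hzy) (hx z hzx).symm hvx hvy hvz).2.1
  have hfg : ∀ v u, f v ≠ g u := by
    rintro ⟨v, hv⟩ ⟨u, hux, huy⟩ e
    have hpos := h.coord_pos hcr hv
    obtain ⟨v1, v2, -⟩ := (mem_triangle hcr _).1 (h v)
    obtain ⟨-, -, u3⟩ := (mem_triangle hcr _).1 (h u)
    have hu := hT u hux huy
    have := coord_of_lineSlope_eq hcr e
    rw [coordS_fst hcr, coordT_fst, coordS_origin, coordT_origin] at this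
    nlinarith
  have hfk : ∀ v i, f v ≠ k i := by
    rintro ⟨v, hv⟩ i e
    have hpos := h.coord_pos hcr hv
    obtain ⟨v1, v2, -⟩ := (mem_triangle hcr _).1 (h v)
    have := coord_of_lineSlope_eq hcr e
    rw [coordS_snd, coordT_snd hcr, coordS_origin, coordT_origin] at this
    nlinarith
  have hgk : ∀ v i, g v ≠ k i := by
    rintro ⟨u, hux, huy⟩ i e
    obtain ⟨-, -, u3⟩ := (mem_triangle hcr _).1 (h u)
    have hu := hT u hux huy
    have := coord_of_lineSlope_eq hcr e
    rw [coordS_snd, coordT_snd hcr, coordS_fst hcr, coordT_fst] at this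
    nlinarith
  have := card_le_numSlopes (D := D) (Sum.elim f (Sum.elim g k))
    (hf.sumElim (hg.sumElim hk hgk) (by
      rintro v (u | i)
      · exact hfg v u
      · exact hfk v i)) (by
    rintro (⟨v, hv⟩ | ⟨v, -, hv⟩ | i)
    · exact ⟨x, v, hx v hv, rfl⟩
    · exact ⟨y, v, hy v hv, rfl⟩
    · exact ⟨z, w, hzw, rfl⟩)
  have hc : Fintype.card {v // v ≠ x} = Fintype.card V - 1 := by simp
  have hc' : Fintype.card {v // v ≠ x ∧ v ≠ y} = Fintype.card V - 2 := by
    rw [Fintype.card_subtype, show (Finset.univ.filter fun v => v ≠ x ∧ v ≠ y) = {x, y}ᶜ by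
      ext; simp, Finset.card_compl, Finset.card_pair hyx.symm]
  rw [Fintype.card_sum, Fintype.card_sum, hc, hc', Fintype.card_unit] at this
  have := Fintype.one_lt_card_iff.2 ⟨y, x, hyx⟩
  omega

end Drawing

/-! ### The graph and its lower bounds -/

/-- The join of an edge, with vertices `0` and `1`, and a path, with vertices `2, …, n - 1`. -/
def edgeJoinPath (n : ℕ) : SimpleGraph (Fin n) where
  Adj i j := i ≠ j ∧ (i.val < 2 ∨ j.val < 2 ∨ i.val + 1 = j.val ∨ j.val + 1 = i.val)
  symm := ⟨fun i j h => ⟨h.1.symm, by tauto⟩⟩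
  loopless := ⟨fun i h => h.1 rfl⟩

namespace edgeJoinPath

open Drawing

variable {n : ℕ}

theorem adj_of_lt_two {i j : Fin n} (hi : i.val < 2) (h : j ≠ i) : (edgeJoinPath n).Adj i j :=
  ⟨h.symm, Or.inl hi⟩

theorem mem_of_mem_triple {α : Type*} {x y z a b c w : α} (hab : a ≠ b) (hbc : b ≠ c) (hca : c ≠ a)
    (ha : a = x ∨ a = y ∨ a = z) (hb : b = x ∨ b = y ∨ b = z) (hc : c = x ∨ c = y ∨ c = z)
    (hw : w = x ∨ w = y ∨ w = z) : w = a ∨ w = b ∨ w = c := by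
  rcases ha with rfl | rfl | rfl <;> rcases hb with rfl | rfl | rfl <;>
    rcases hc with rfl | rfl | rfl <;> tauto

/-- Induction along the path. The new vertex `p` is adjacent to `0`, `1` and its predecessor. If it
falls outside the current triangle, these three neighbours must be the corners, and then the
triangle grows to one with corner `p` that swallows one of them. -/
theorem exists_triangle {D : Drawing (edgeJoinPath n)} (hD : D.IsPlane) (k : ℕ) (hk : 3 ≤ k)
    (hkn : k ≤ n) : ∃ x y z : Fin n, x.val < 2 ∧ y.val < k ∧ z.val < k ∧ y ≠ x ∧ z ≠ x ∧
      (edgeJoinPath n).Adj y z ∧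
      ∀ v : Fin n, v.val < k → D.pos v ∈ convexHull ℝ {D.pos x, D.pos y, D.pos z} := by
  induction k, hk using Nat.le_induction with
  | base =>
    refine ⟨⟨0, by omega⟩, ⟨1, by omega⟩, ⟨2, by omega⟩, by simp, by simp, by simp, by simp,
      by simp, ⟨by simp, by simp⟩, fun v hv => pos_mem_of_eq ?_⟩
    simp only [Fin.ext_iff]
    omega
  | succ k hk ih =>
    obtain ⟨x, y, z, hx, hy, hz, hyx, hzx, hyz, hv⟩ := ih (by omega)
    have hxy := adj_of_lt_two hx hyx
    have hzx' := (adj_of_lt_two hx hzx).symm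
    let p : Fin n := ⟨k, by omega⟩
    by_cases hp : D.pos p ∈ convexHull ℝ {D.pos x, D.pos y, D.pos z}
    · refine ⟨x, y, z, hx, by omega, by omega, hyx, hzx, hyz, fun v hvk => ?_⟩
      rcases Nat.lt_succ_iff_lt_or_eq.1 hvk with h | h
      · exact hv v h
      · rwa [show v = p from Fin.ext h]
    · let a : Fin n := ⟨0, by omega⟩
      let b : Fin n := ⟨1, by omega⟩
      let c : Fin n := ⟨k - 1, by omega⟩
      have hpa : (edgeJoinPath n).Adj p a := ⟨by simp [p, a, Fin.ext_iff]; omega, by simp [a]⟩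
      have hpb : (edgeJoinPath n).Adj p b := ⟨by simp [p, b, Fin.ext_iff]; omega, by simp [b]⟩
      have hpc : (edgeJoinPath n).Adj p c :=
        ⟨by simp [p, c, Fin.ext_iff]; omega, by simp [p, c]; omega⟩
      have hab : (edgeJoinPath n).Adj a b := ⟨by simp [a, b], by simp [a]⟩
      have hbc : (edgeJoinPath n).Adj b c := ⟨by simp [b, c]; omega, by simp [b]⟩
      have hca : (edgeJoinPath n).Adj c a := ⟨by simp [c, a]; omega, by simp [a]⟩
      have ha := hD.mem_of_adj_outside hxy hyz hzx' hp (hv a (by simp [a]; omega)) hpa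
      have hb := hD.mem_of_adj_outside hxy hyz hzx' hp (hv b (by simp [b]; omega)) hpb
      have hc := hD.mem_of_adj_outside hxy hyz hzx' hp (hv c (by simp [c]; omega)) hpc
      -- Three distinct neighbours among three corners: the current triangle is exactly `abc`.
      have hsub : ∀ w : Fin n, (w = x ∨ w = y ∨ w = z) → w = a ∨ w = b ∨ w = c :=
        fun w => mem_of_mem_triple hab.ne hbc.ne hca.ne ha hb hc
      have hle : convexHull ℝ {D.pos x, D.pos y, D.pos z} ⊆
          convexHull ℝ {D.pos a, D.pos b, D.pos c} :=
        convexHull_min (by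
          rintro _ (rfl | rfl | rfl) <;> exact pos_mem_of_eq (hsub _ (by simp)))
          (convex_convexHull ℝ _)
      have hp' : D.pos p ∉ convexHull ℝ {D.pos a, D.pos b, D.pos c} := by
        refine fun h => hp (convexHull_min ?_ (convex_convexHull ℝ _) h)
        rintro _ (rfl | rfl | rfl)
        exacts [pos_mem_of_eq ha, pos_mem_of_eq hb, pos_mem_of_eq hc]
      have fin : ∀ d e : Fin n, D.pos a ∈ convexHull ℝ {D.pos p, D.pos d, D.pos e} →
          D.pos b ∈ convexHull ℝ {D.pos p, D.pos d, D.pos e} →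
          D.pos c ∈ convexHull ℝ {D.pos p, D.pos d, D.pos e} →
          ∀ v : Fin n, v.val < k + 1 →
          D.pos v ∈ convexHull ℝ {D.pos d, D.pos e, D.pos p} := by
        intro d e h1 h2 h3 v hvk
        rw [Set.pair_comm (D.pos e), Set.insert_comm (D.pos d)]
        rcases Nat.lt_succ_iff_lt_or_eq.1 hvk with h | h
        · refine convexHull_min ?_ (convex_convexHull ℝ _) (hle (hv v h))
          rintro _ (rfl | rfl | rfl) <;> assumption
        · exact pos_mem_of_eq (Or.inl (Fin.ext h))
      -- Whichever corner is swallowed, `a` or `b` survives and takes the role of `x`.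
      rcases hD.exists_mem_triangle hab hbc hca hpa hpb hpc hp' with h | h | h
      · exact ⟨b, c, p, by simp [b], by simp [c], by simp [p], hbc.ne', hpb.ne, hpc.symm,
          fin b c h (pos_mem_of_eq (by simp)) (pos_mem_of_eq (by simp))⟩
      · refine ⟨a, c, p, by simp [a], by simp [c], by simp [p], hca.ne, hpa.ne, hpc.symm,
          ?_⟩
        rw [show ({D.pos a, D.pos c, D.pos p} : Set (ℝ × ℝ)) = {D.pos c, D.pos a, D.pos p} from
          Set.insert_comm _ _ _]
        exact fin c a (pos_mem_of_eq (by simp)) h (pos_mem_of_eq (by simp))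
      · exact ⟨a, b, p, by simp [a], by simp [b]; omega, by simp [p], hab.ne', hpa.ne, hpb.symm,
          fin a b (pos_mem_of_eq (by simp)) (pos_mem_of_eq (by simp)) h⟩

theorem add_two_le_numSlopes (hn : 4 ≤ n) {D : Drawing (edgeJoinPath n)} (hD : D.IsPlane) :
    n + 2 ≤ D.numSlopes := by
  obtain ⟨x, y, z, hx, -, -, hyx, hzx, hyz, hv⟩ := exists_triangle hD n (by omega) le_rfl
  obtain ⟨w, hwx, hyw, hzw⟩ : ∃ w : Fin n, w ≠ x ∧ (edgeJoinPath n).Adj y w ∧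
      (edgeJoinPath n).Adj z w := by
    obtain ⟨hne, hyz⟩ := hyz
    simp only [edgeJoinPath, ne_eq, Fin.ext_iff] at *
    -- If `y` or `z` is the second dominating vertex, `w` is a path neighbour of the other one,
    -- which exists as `n ≥ 4`. Otherwise both are on the path and `w` is the second dominating
    -- vertex.
    by_cases hy : y.val < 2
    · by_cases hz : z.val + 1 < n
      · exact ⟨⟨z + 1, hz⟩, by simp; omega⟩
      · exact ⟨⟨z - 1, by omega⟩, by simp; omega⟩
    · by_cases hz : z.val < 2
      · by_cases hy : y.val + 1 < n
        · exact ⟨⟨y + 1, hy⟩, by simp; omega⟩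
        · exact ⟨⟨y - 1, by omega⟩, by simp; omega⟩
      · exact ⟨⟨1 - x.val, by omega⟩, by dsimp only; omega⟩
  simpa using Encloses.card_add_two_le (fun v => hv v v.2) hyz (fun v => adj_of_lt_two hx) hyx hzx hwx hyw hzw

theorem two_mul_sub_two_le_numSlopes (hn : 4 ≤ n) {D : Drawing (edgeJoinPath n)} (hD : D.IsPlane)
    (hO : D.HasOuterface ⟨0, by omega⟩ ⟨1, by omega⟩ ⟨n - 1, by omega⟩) :
    2 * n - 2 ≤ D.numSlopes := by
  obtain ⟨x, y, z, hx, -, -, hyx, hzx, hyz, hv⟩ := exists_triangle hD n (by omega) le_rfl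
  have h : D.Encloses x y z := fun v => hv v v.2
  have h' := h.of_hasOuterface (adj_of_lt_two hx hyx) hyz (adj_of_lt_two hx hzx).symm hO
  have h01 : (⟨1, by omega⟩ : Fin n) ≠ ⟨0, by omega⟩ := by simp
  have hz0 : (⟨n - 1, by omega⟩ : Fin n) ≠ ⟨0, by omega⟩ := by simp [Fin.ext_iff]; omega
  have hz1 : (⟨n - 1, by omega⟩ : Fin n) ≠ ⟨1, by omega⟩ := by simp [Fin.ext_iff]; omega
  have hw0 : (⟨n - 2, by omega⟩ : Fin n) ≠ ⟨0, by omega⟩ := by simp [Fin.ext_iff]; omega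
  have hw1 : (⟨n - 2, by omega⟩ : Fin n) ≠ ⟨1, by omega⟩ := by simp [Fin.ext_iff]; omega
  have hzw : (edgeJoinPath n).Adj ⟨n - 1, by omega⟩ ⟨n - 2, by omega⟩ :=
    ⟨by simp [Fin.ext_iff]; omega, by dsimp only; omega⟩
  simpa using h'.two_mul_card_sub_two_le (fun v => adj_of_lt_two (by simp))
    (fun v => adj_of_lt_two (by simp)) h01 hz0 hz1 hw0 hw1 hzw

end edgeJoinPath

/-- The frontier consists of edges and so avoids the complement of the support; a connected region
with this property is a whole component. -/
theorem Drawing.face_eq_of_region {V : Type*} {G : SimpleGraph V} {D : Drawing G}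
    {R : Set (ℝ × ℝ)} {a b c : V} (hab : G.Adj a b) (hbc : G.Adj b c) (hca : G.Adj c a)
    (hR : IsPreconnected R) (hRD : R ⊆ D.supportᶜ)
    (hfr : frontier R = sides (D.pos a) (D.pos b) (D.pos c)) {p : ℝ × ℝ} (hp : p ∈ R) :
    connectedComponentIn D.supportᶜ p = R ∧ D.IsBoundedByTriangle R a b c := by
  refine ⟨connectedComponentIn_eq_of_frontier hR hRD ?_ hp, hab, hbc, hca, hfr⟩
  rw [hfr, disjoint_compl_right_iff_subset]
  rintro q ((hq | hq) | hq)
  exacts [Or.inr ⟨a, b, hab, hq⟩, Or.inr ⟨b, c, hbc, hq⟩, Or.inr ⟨c, a, hca, hq⟩]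

namespace edgeJoinPath

open Drawing

variable {n : ℕ}

/-! ### The standard drawing is plane -/

/-- The positions of the vertices of `edgeJoinPath n` in its standard drawing: the path lies on the
`y`-axis, and the vertices `0` and `1` are at `(-1, 0)` and `(1, 0)`. -/
noncomputable def stdPos (i : Fin n) : ℝ × ℝ :=
  if i.val = 0 then (-1, 0) else if i.val = 1 then (1, 0) else (0, i.val)

theorem stdPos_zero {i : Fin n} (h : i.val = 0) : stdPos i = (-1, 0) := by simp [stdPos, h]

theorem stdPos_one {i : Fin n} (h : i.val = 1) : stdPos i = (1, 0) := by simp [stdPos, h]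

theorem stdPos_path {i : Fin n} (h : 2 ≤ i.val) : stdPos i = (0, (i.val : ℝ)) := by
  rw [stdPos, if_neg (by omega), if_neg (by omega)]

theorem stdPos_injective : Function.Injective (stdPos (n := n)) := by
  intro i j h
  rcases (by omega : i.val = 0 ∨ i.val = 1 ∨ 2 ≤ i.val) with hi | hi | hi <;>
    rcases (by omega : j.val = 0 ∨ j.val = 1 ∨ 2 ≤ j.val) with hj | hj | hj <;>
    simp only [stdPos_zero, stdPos_one, stdPos_path, hi, hj, Prod.mk.injEq] at h <;>
    first
    | exact Fin.ext (by omega)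
    | exact Fin.ext (by exact_mod_cast h.2)
    | (exfalso; norm_num at h)

/-- The four types are the base, the left and right spokes, and the path edges. Their linear
equations reduce incidence questions to arithmetic. -/
theorem mem_edge_cases {a b : Fin n} (hab : (edgeJoinPath n).Adj a b) (hlt : a < b) {p : ℝ × ℝ}
    (hp : p ∈ segment ℝ (stdPos a) (stdPos b)) :
    (a.val = 0 ∧ b.val = 1 ∧ p.2 = 0 ∧ -1 ≤ p.1 ∧ p.1 ≤ 1) ∨
    (a.val = 0 ∧ 2 ≤ b.val ∧ p.2 = b.val * (1 + p.1) ∧ -1 ≤ p.1 ∧ p.1 ≤ 0) ∨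
    (a.val = 1 ∧ 2 ≤ b.val ∧ p.2 = b.val * (1 - p.1) ∧ 0 ≤ p.1 ∧ p.1 ≤ 1) ∨
    (2 ≤ a.val ∧ b.val = a.val + 1 ∧ p.1 = 0 ∧ (a.val : ℝ) ≤ p.2 ∧ p.2 ≤ a.val + 1) := by
  obtain ⟨s, t, hs, ht, hst, rfl⟩ := hp
  obtain rfl : s = 1 - t := by linarith
  have hlt' : a.val < b.val := hlt
  rcases (by have := hab.2; omega : (a.val = 0 ∧ b.val = 1) ∨ (a.val = 0 ∧ 2 ≤ b.val) ∨
    (a.val = 1 ∧ 2 ≤ b.val) ∨ (2 ≤ a.val ∧ b.val = a.val + 1)) with h | h | h | h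
  · refine Or.inl ⟨h.1, h.2, ?_⟩
    rw [stdPos_zero h.1, stdPos_one h.2]
    simp only [Prod.snd_add, Prod.fst_add, Prod.smul_fst, Prod.smul_snd, smul_eq_mul]
    refine ⟨by ring, by linarith, by linarith⟩
  · refine Or.inr (Or.inl ⟨h.1, h.2, ?_⟩)
    rw [stdPos_zero h.1, stdPos_path h.2]
    simp only [Prod.snd_add, Prod.fst_add, Prod.smul_fst, Prod.smul_snd, smul_eq_mul]
    refine ⟨by ring, by linarith, by linarith⟩
  · refine Or.inr (Or.inr (Or.inl ⟨h.1, h.2, ?_⟩))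
    rw [stdPos_one h.1, stdPos_path h.2]
    simp only [Prod.snd_add, Prod.fst_add, Prod.smul_fst, Prod.smul_snd, smul_eq_mul]
    refine ⟨by ring, by linarith, by linarith⟩
  · refine Or.inr (Or.inr (Or.inr ⟨h.1, h.2, ?_⟩))
    rw [stdPos_path h.1, stdPos_path (by omega), h.2]
    simp only [Prod.snd_add, Prod.fst_add, Prod.smul_fst, Prod.smul_snd, smul_eq_mul]
    push_cast
    refine ⟨by ring, by linarith, by linarith⟩

theorem eq_of_stdPos_mem_edge {a b w : Fin n} (hab : (edgeJoinPath n).Adj a b) (hlt : a < b)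
    (hw : stdPos w ∈ segment ℝ (stdPos a) (stdPos b)) : w = a ∨ w = b := by
  simp only [Fin.ext_iff]
  have h := mem_edge_cases hab hlt hw
  rcases (by omega : w.val = 0 ∨ w.val = 1 ∨ 2 ≤ w.val) with hw | hw | hw
  · rw [stdPos_zero hw] at h
    norm_num at h
    omega
  · rw [stdPos_one hw] at h
    norm_num at h
    omega
  · rw [stdPos_path hw] at h
    norm_num at h
    norm_cast at h
    omega

/-- The standard drawing of `edgeJoinPath n`. -/
noncomputable def stdDrawing (n : ℕ) : Drawing (edgeJoinPath n) where
  pos := stdPos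
  pos_injective := stdPos_injective
  vertex_of_mem_edge a b w hab hw := by
    rcases lt_or_gt_of_ne hab.ne with h | h
    · exact eq_of_stdPos_mem_edge hab h hw
    · rw [segment_symm] at hw
      exact (eq_of_stdPos_mem_edge hab.symm h hw).symm

theorem stdDrawing_pos (i : Fin n) : (stdDrawing n).pos i = stdPos i := rfl

theorem exists_common_endpoint {a b c d : Fin n} (hab : (edgeJoinPath n).Adj a b)
    (hcd : (edgeJoinPath n).Adj c d) (hlt : a < b) (hlt' : c < d) (hne : ¬(a = c ∧ b = d))
    {p : ℝ × ℝ} (hp : p ∈ segment ℝ (stdPos a) (stdPos b))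
    (hp' : p ∈ segment ℝ (stdPos c) (stdPos d)) :
    ∃ w, (w = a ∨ w = b) ∧ (w = c ∨ w = d) ∧ p = stdPos w := by
  have common : ∀ w v : Fin n, w.val = v.val → (w = a ∨ w = b) → (v = c ∨ v = d) →
      p = stdPos w → ∃ w, (w = a ∨ w = b) ∧ (w = c ∨ w = d) ∧ p = stdPos w :=
    fun w v h h1 h2 h3 => ⟨w, h1, Fin.ext h ▸ h2, h3⟩
  -- Two lines of different slope through `(-1, 0)`, or through `(1, 0)`, meet only there; the base
  -- is the case of slope `0`.
  have apex : ∀ {k l : ℕ} {t y : ℝ}, y = k * t → y = l * t → k ≠ l → t = 0 ∧ y = 0 := by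
    intro k l t y h1 h2 hkl
    have h3 : ((k : ℝ) - l) * t = 0 := by linarith
    have h4 : (k : ℝ) - l ≠ 0 := sub_ne_zero.2 (by exact_mod_cast hkl)
    have h5 := (mul_eq_zero.1 h3).resolve_left h4
    exact ⟨h5, by rw [h1, h5, mul_zero]⟩
  have hne' : ¬(a.val = c.val ∧ b.val = d.val) := fun h => hne ⟨Fin.ext h.1, Fin.ext h.2⟩
  have zero : ∀ {i : Fin n}, i.val = 0 → 1 + p.1 = 0 → p.2 = 0 → p = stdPos i := fun hi h1 h2 => by
    rw [stdPos_zero hi]; exact Prod.ext (by simp only; linarith) h2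
  have one : ∀ {i : Fin n}, i.val = 1 → 1 - p.1 = 0 → p.2 = 0 → p = stdPos i := fun hi h1 h2 => by
    rw [stdPos_one hi]; exact Prod.ext (by simp only; linarith) h2
  have path : ∀ {i : Fin n}, 2 ≤ i.val → p.1 = 0 → p.2 = i.val → p = stdPos i := fun hi h1 h2 => by
    rw [stdPos_path hi]; exact Prod.ext h1 h2
  rcases mem_edge_cases hab hlt hp with ⟨ha, hb, h1, h2, h3⟩ | ⟨ha, hb, h1, h2, h3⟩ |
      ⟨ha, hb, h1, h2, h3⟩ | ⟨ha, hb, h1, h2, h3⟩ <;>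
    rcases mem_edge_cases hcd hlt' hp' with ⟨hc, hd, h4, h5, h6⟩ | ⟨hc, hd, h4, h5, h6⟩ |
      ⟨hc, hd, h4, h5, h6⟩ | ⟨hc, hd, h4, h5, h6⟩
  · omega
  · have := apex (k := 0) (by simpa using h1) h4 (by omega)
    exact common a c (by omega) (by simp) (by simp) (zero ha this.1 this.2)
  · have := apex (k := 0) (by simpa using h1) h4 (by omega)
    exact common b c (by omega) (by simp) (by simp) (one hb this.1 this.2)
  · have : (2 : ℝ) ≤ c.val := by exact_mod_cast hc
    linarith
  · have := apex (k := 0) (by simpa using h4) h1 (by omega)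
    exact common a c (by omega) (by simp) (by simp) (zero ha this.1 this.2)
  · have := apex h1 h4 (by omega)
    exact common a c (by omega) (by simp) (by simp) (zero ha this.1 this.2)
  · have hX : p.1 = 0 := le_antisymm h3 h5
    rw [hX] at h1 h4
    have hbd : (b.val : ℝ) = d.val := by linarith
    exact common b d (by exact_mod_cast hbd) (by simp) (by simp) (path hb hX (by linarith))
  · rw [h4, add_zero, mul_one] at h1
    rw [h1] at h5 h6
    norm_cast at h5 h6
    rcases (by omega : b.val = c.val ∨ b.val = d.val) with h | h
    · exact common b c h (by simp) (by simp) (path hb h4 h1)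
    · exact common b d h (by simp) (by simp) (path hb h4 h1)
  · have := apex (k := 0) (by simpa using h4) h1 (by omega)
    exact common a d (by omega) (by simp) (by simp) (one ha this.1 this.2)
  · have hX : p.1 = 0 := le_antisymm h6 h2
    rw [hX] at h1 h4
    have hbd : (b.val : ℝ) = d.val := by linarith
    exact common b d (by exact_mod_cast hbd) (by simp) (by simp) (path hb hX (by linarith))
  · have := apex h1 h4 (by omega)
    exact common a c (by omega) (by simp) (by simp) (one ha this.1 this.2)
  · rw [h4, sub_zero, mul_one] at h1
    rw [h1] at h5 h6
    norm_cast at h5 h6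
    rcases (by omega : b.val = c.val ∨ b.val = d.val) with h | h
    · exact common b c h (by simp) (by simp) (path hb h4 h1)
    · exact common b d h (by simp) (by simp) (path hb h4 h1)
  · have : (2 : ℝ) ≤ a.val := by exact_mod_cast ha
    linarith
  · rw [h1, add_zero, mul_one] at h4
    rw [h4] at h2 h3
    norm_cast at h2 h3
    rcases (by omega : a.val = d.val ∨ b.val = d.val) with h | h
    · exact common a d h (by simp) (by simp) (path ha h1 (by rw [h4, h]))
    · exact common b d h (by simp) (by simp) (path (by omega) h1 (by rw [h4, h]))
  · rw [h1, sub_zero, mul_one] at h4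
    rw [h4] at h2 h3
    norm_cast at h2 h3
    rcases (by omega : a.val = d.val ∨ b.val = d.val) with h | h
    · exact common a d h (by simp) (by simp) (path ha h1 (by rw [h4, h]))
    · exact common b d h (by simp) (by simp) (path (by omega) h1 (by rw [h4, h]))
  · have h7 : (a.val : ℝ) ≤ c.val + 1 := by linarith
    have h8 : (c.val : ℝ) ≤ a.val + 1 := by linarith
    norm_cast at h7 h8
    rcases (by omega : a.val = d.val ∨ b.val = c.val) with h | h
    · refine common a d h (by simp) (by simp) (path ha h1 (le_antisymm ?_ h2))
      rw [h, hd]; push_cast; exact h6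
    · refine common b c h (by simp) (by simp) (path (by omega) h1 (le_antisymm ?_ ?_))
      · rw [hb]; push_cast; exact h3
      · rw [h]; exact h5

theorem stdDrawing_isPlane : (stdDrawing n).IsPlane := by
  intro a b c d hab hcd hne p hp
  wlog h : a < b generalizing a b
  · rw [segment_symm ℝ ((stdDrawing n).pos a)] at hp
    rw [Sym2.eq_swap (a := a)] at hne
    obtain ⟨w, h1, h2⟩ := this hab.symm hne hp (lt_of_le_of_ne (not_lt.1 h) hab.ne')
    exact ⟨w, h1.symm, h2⟩
  wlog h' : c < d generalizing c d
  · rw [segment_symm ℝ ((stdDrawing n).pos c)] at hp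
    rw [Sym2.eq_swap (a := c)] at hne
    obtain ⟨w, h1, h2, h3⟩ := this hcd.symm hne hp (lt_of_le_of_ne (not_lt.1 h') hcd.ne')
    exact ⟨w, h1, h2.symm, h3⟩
  exact exists_common_endpoint hab hcd h h' (fun e => hne (by rw [e.1, e.2])) hp.1 hp.2

/-- The two spokes to height `k` together form the tent `y = k(1 - |x|)`. Dropping the upper bounds
on `k` and on the path loses nothing, since this is used only to show that regions avoid the
drawing. -/
theorem mem_stdDrawing_support {p : ℝ × ℝ} (hn : 2 ≤ n) (hp : p ∈ (stdDrawing n).support) :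
    p.2 = 0 ∨ (∃ k : ℕ, 2 ≤ k ∧ p.2 = k * (1 - |p.1|) ∧ |p.1| ≤ 1) ∨ (p.1 = 0 ∧ 2 ≤ p.2) := by
  obtain ⟨a, b, hab, hp⟩ : ∃ a b : Fin n, (edgeJoinPath n).Adj a b ∧
      p ∈ segment ℝ (stdPos a) (stdPos b) := by
    rcases hp with ⟨v, rfl⟩ | hp
    · obtain ⟨u, hu⟩ : ∃ u : Fin n, (edgeJoinPath n).Adj v u := by
        by_cases hv : v.val = 0
        · exact ⟨⟨1, by omega⟩, by simp [Fin.ext_iff, hv], by simp⟩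
        · exact ⟨⟨0, by omega⟩, by simp [Fin.ext_iff, hv], by simp⟩
      exact ⟨v, u, hu, left_mem_segment _ _ _⟩
    · exact hp
  wlog h : a < b generalizing a b
  · rw [segment_symm] at hp
    exact this b a hab.symm hp (lt_of_le_of_ne (not_lt.1 h) hab.ne')
  rcases mem_edge_cases hab h hp with ⟨ha, hb, h1, h2, h3⟩ | ⟨ha, hb, h1, h2, h3⟩ |
      ⟨ha, hb, h1, h2, h3⟩ | ⟨ha, hb, h1, h2, h3⟩
  · exact Or.inl h1
  · refine Or.inr (Or.inl ⟨b, hb, ?_⟩)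
    rw [abs_of_nonpos h3, sub_neg_eq_add]
    exact ⟨h1, by linarith⟩
  · refine Or.inr (Or.inl ⟨b, hb, ?_⟩)
    rw [abs_of_nonneg h2]
    exact ⟨h1, h3⟩
  · have : (2 : ℝ) ≤ a.val := by exact_mod_cast ha
    exact Or.inr (Or.inr ⟨h1, by linarith⟩)

theorem mem_support_of_mem_edge {a b : Fin n} (hab : (edgeJoinPath n).Adj a b) {p : ℝ × ℝ}
    (t : ℝ) (h0 : 0 ≤ t) (h1 : t ≤ 1) (hp : p = (1 - t) • stdPos a + t • stdPos b) :
    p ∈ (stdDrawing n).support :=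
  Or.inr ⟨a, b, hab, 1 - t, t, by linarith, h0, by ring, hp.symm⟩

theorem base_mem_support (hn : 2 ≤ n) {x : ℝ} (hx : |x| ≤ 1) :
    ((x, 0) : ℝ × ℝ) ∈ (stdDrawing n).support := by
  obtain ⟨h1, h2⟩ := abs_le.1 hx
  refine mem_support_of_mem_edge (a := ⟨0, by omega⟩) (b := ⟨1, by omega⟩)
    ⟨by simp, by simp⟩ ((1 + x) / 2) (by linarith) (by linarith) ?_
  rw [stdPos_zero rfl, stdPos_one rfl]
  ext <;> simp
  ring

theorem spoke_mem_support {k : ℕ} (hk : 2 ≤ k) (hkn : k < n) {x : ℝ} (hx : |x| ≤ 1) :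
    ((x, k * (1 - |x|)) : ℝ × ℝ) ∈ (stdDrawing n).support := by
  obtain ⟨h1, h2⟩ := abs_le.1 hx
  rcases le_total x 0 with h | h
  · refine mem_support_of_mem_edge (a := ⟨0, by omega⟩) (b := ⟨k, hkn⟩)
      ⟨by simp [Fin.ext_iff]; omega, by simp⟩ (1 + x) (by linarith) (by linarith) ?_
    rw [stdPos_zero rfl, stdPos_path hk, abs_of_nonpos h]
    ext <;> simp
    ring
  · refine mem_support_of_mem_edge (a := ⟨1, by omega⟩) (b := ⟨k, hkn⟩)
      ⟨by simp [Fin.ext_iff]; omega, by simp⟩ (1 - x) (by linarith) (by linarith) ?_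
    rw [stdPos_one rfl, stdPos_path hk, abs_of_nonneg h]
    ext <;> simp
    ring

theorem path_mem_support {k : ℕ} (hk : 2 ≤ k) (hkn : k + 1 < n) {y : ℝ} (h1 : (k : ℝ) ≤ y)
    (h2 : y ≤ k + 1) : ((0, y) : ℝ × ℝ) ∈ (stdDrawing n).support := by
  refine mem_support_of_mem_edge (a := ⟨k, by omega⟩) (b := ⟨k + 1, hkn⟩)
    ⟨by simp, by simp⟩ (y - k) (by linarith) (by linarith) ?_
  rw [stdPos_path hk, stdPos_path (by dsimp only; omega)]
  ext <;> simp
  ring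

/-! ### Faces of the standard drawing -/

theorem cross_base (H : ℝ) :
    cross (((1, 0) : ℝ × ℝ) - (-1, 0)) (((0, H) : ℝ × ℝ) - (-1, 0)) = 2 * H := by
  simp only [cross, Prod.fst_sub, Prod.snd_sub]; ring

theorem mem_base_triangle {H : ℝ} (hH : 0 < H) (p : ℝ × ℝ) :
    p ∈ convexHull ℝ {((-1, 0) : ℝ × ℝ), (1, 0), (0, H)} ↔
      0 ≤ p.2 ∧ p.2 ≤ H * (1 - |p.1|) := by
  have hc := cross_base H
  rw [mem_triangle (by rw [hc]; positivity), coordS, coordT, hc, ← add_div,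
    le_div_iff₀ (by positivity), le_div_iff₀ (by positivity), zero_mul,
    div_le_one (by positivity)]
  simp only [cross, Prod.fst_sub, Prod.snd_sub]
  rcases le_total p.1 0 with h | h
  · rw [abs_of_nonpos h]
    constructor
    · rintro ⟨h1, h2, h3⟩
      constructor <;> linarith
    · rintro ⟨h1, h2⟩
      refine ⟨by linarith, by linarith, ?_⟩
      nlinarith
  · rw [abs_of_nonneg h]
    constructor
    · rintro ⟨h1, h2, h3⟩
      constructor <;> linarith
    · rintro ⟨h1, h2⟩
      refine ⟨?_, by linarith, by linarith⟩
      nlinarith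

theorem mem_base_openTriangle (p : ℝ × ℝ) :
    p ∈ openTriangle (-1, 0) (1, 0) (0, 2) ↔ 0 < p.2 ∧ p.2 < 2 * (1 - |p.1|) := by
  have hc := cross_base 2
  rw [openTriangle, mem_ofPred_eq, coordS, coordT, hc, ← add_div,
    div_pos_iff_of_pos_right (by norm_num), div_pos_iff_of_pos_right (by norm_num),
    div_lt_one (by norm_num)]
  simp only [cross, Prod.fst_sub, Prod.snd_sub]
  rcases le_total p.1 0 with h | h
  · rw [abs_of_nonpos h]
    constructor
    · rintro ⟨h1, h2, h3⟩
      constructor <;> linarith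
    · rintro ⟨h1, h2⟩
      refine ⟨by linarith, by linarith, by linarith⟩
  · rw [abs_of_nonneg h]
    constructor
    · rintro ⟨h1, h2, h3⟩
      constructor <;> linarith
    · rintro ⟨h1, h2⟩
      refine ⟨by linarith, by linarith, by linarith⟩

theorem cross_left (k : ℝ) :
    cross (((0, k) : ℝ × ℝ) - (-1, 0)) (((0, k + 1) : ℝ × ℝ) - (-1, 0)) = 1 := by
  simp [cross]

theorem cross_right (k : ℝ) :
    cross (((0, k) : ℝ × ℝ) - (1, 0)) (((0, k + 1) : ℝ × ℝ) - (1, 0)) = -1 := by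
  simp [cross]

theorem mem_left_openTriangle (k : ℝ) (p : ℝ × ℝ) :
    p ∈ openTriangle (-1, 0) (0, k) (0, k + 1) ↔
      p.1 < 0 ∧ k * (1 - |p.1|) < p.2 ∧ p.2 < (k + 1) * (1 - |p.1|) := by
  rw [openTriangle, mem_ofPred_eq, coordS, coordT, cross_left]
  simp only [cross, Prod.fst_sub, Prod.snd_sub, div_one]
  constructor
  · rintro ⟨h1, h2, h3⟩
    have h : p.1 < 0 := by linarith
    rw [abs_of_neg h]
    refine ⟨h, ?_, ?_⟩ <;> linarith
  · rintro ⟨h, h2, h3⟩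
    rw [abs_of_neg h] at h2 h3
    refine ⟨?_, ?_, ?_⟩ <;> linarith

theorem mem_right_openTriangle (k : ℝ) (p : ℝ × ℝ) :
    p ∈ openTriangle (1, 0) (0, k) (0, k + 1) ↔
      0 < p.1 ∧ k * (1 - |p.1|) < p.2 ∧ p.2 < (k + 1) * (1 - |p.1|) := by
  rw [openTriangle, mem_ofPred_eq, coordS, coordT, cross_right]
  simp only [cross, Prod.fst_sub, Prod.snd_sub, div_neg, div_one]
  constructor
  · rintro ⟨h1, h2, h3⟩
    have h : 0 < p.1 := by linarith
    rw [abs_of_pos h]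
    refine ⟨h, ?_, ?_⟩ <;> linarith
  · rintro ⟨h, h2, h3⟩
    rw [abs_of_pos h] at h2 h3
    refine ⟨?_, ?_, ?_⟩ <;> linarith

/-- No integer lies strictly between `k` and `k + 1`, so no tent passes between two consecutive
ones; off the axis there are no path edges either. -/
theorem notMem_support_of_between (hn : 2 ≤ n) {k : ℕ} {p : ℝ × ℝ} (hp : p.1 ≠ 0)
    (h1 : k * (1 - |p.1|) < p.2) (h2 : p.2 < (k + 1) * (1 - |p.1|)) :
    p ∉ (stdDrawing n).support := by
  intro h
  have h0 : 0 < 1 - |p.1| := by linarith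
  rcases mem_stdDrawing_support hn h with h | ⟨j, -, h, -⟩ | ⟨h, -⟩
  · have := mul_nonneg (Nat.cast_nonneg (α := ℝ) k) h0.le
    linarith
  · rw [h] at h1 h2
    have h3 := lt_of_mul_lt_mul_right h1 h0.le
    have h4 := lt_of_mul_lt_mul_right h2 h0.le
    norm_cast at h3 h4
    omega
  · exact hp h

theorem base_openTriangle_subset (hn : 2 ≤ n) :
    openTriangle (-1, 0) (1, 0) (0, 2) ⊆ (stdDrawing n).supportᶜ := by
  intro p hp h
  obtain ⟨h1, h2⟩ := (mem_base_openTriangle p).1 hp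
  rcases mem_stdDrawing_support hn h with h | ⟨j, hj, h, -⟩ | ⟨h, h'⟩
  · linarith
  · have hj' : (2 : ℝ) ≤ j := by exact_mod_cast hj
    have := mul_le_mul_of_nonneg_right hj' (show (0 : ℝ) ≤ 1 - |p.1| by linarith)
    linarith
  · rw [h, abs_zero] at h2
    linarith

theorem stdDrawing_encloses (hn : 3 ≤ n) :
    (stdDrawing n).Encloses ⟨0, by omega⟩ ⟨1, by omega⟩ ⟨n - 1, by omega⟩ := by
  intro v
  simp only [stdDrawing_pos]
  have hH : (0 : ℝ) < (n - 1 : ℕ) := by exact_mod_cast (by omega : 0 < n - 1)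
  rw [stdPos_zero rfl, stdPos_one rfl, stdPos_path (by dsimp only; omega), mem_base_triangle hH]
  rcases (by omega : v.val = 0 ∨ v.val = 1 ∨ 2 ≤ v.val) with h | h | h
  · rw [stdPos_zero h]; simp
  · rw [stdPos_one h]; simp
  · rw [stdPos_path h]
    have : v.val ≤ n - 1 := by omega
    simpa using this

theorem outer_region (hn : 3 ≤ n) {p : ℝ × ℝ}
    (hp : p ∉ convexHull ℝ {((-1, 0) : ℝ × ℝ), (1, 0), (0, ((n - 1 : ℕ) : ℝ))}) :
    connectedComponentIn (stdDrawing n).supportᶜ p =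
      (convexHull ℝ {((-1, 0) : ℝ × ℝ), (1, 0), (0, ((n - 1 : ℕ) : ℝ))})ᶜ ∧
    (stdDrawing n).IsBoundedByTriangle
      (convexHull ℝ {((-1, 0) : ℝ × ℝ), (1, 0), (0, ((n - 1 : ℕ) : ℝ))})ᶜ
      ⟨0, by omega⟩ ⟨1, by omega⟩ ⟨n - 1, by omega⟩ := by
  have hH : (0 : ℝ) < (n - 1 : ℕ) := by exact_mod_cast (by omega : 0 < n - 1)
  have e0 : (stdDrawing n).pos ⟨0, by omega⟩ = (-1, 0) :=
    (stdDrawing_pos _).trans (stdPos_zero rfl)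
  have e1 : (stdDrawing n).pos ⟨1, by omega⟩ = (1, 0) :=
    (stdDrawing_pos _).trans (stdPos_one rfl)
  have e2 : (stdDrawing n).pos ⟨n - 1, by omega⟩ = (0, ((n - 1 : ℕ) : ℝ)) :=
    stdPos_path (by dsimp only; omega)
  have hcr : cross (((1, 0) : ℝ × ℝ) - (-1, 0)) (((0, ((n - 1 : ℕ) : ℝ)) : ℝ × ℝ) - (-1, 0)) ≠ 0 := by
    rw [cross_base]; positivity
  refine face_eq_of_region (G := edgeJoinPath n) ⟨by simp, by simp⟩
    ⟨by simp [Fin.ext_iff]; omega, by simp⟩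
    ⟨by simp [Fin.ext_iff]; omega, by simp⟩ (isPreconnected_compl_triangle hcr) ?_ ?_ hp
  · have := (stdDrawing_encloses hn).support_subset
    rw [e0, e1, e2] at this
    exact compl_subset_compl.2 this
  · rw [e0, e1, e2, frontier_compl_triangle hcr]

theorem stdDrawing_isTriangulated (hn : 3 ≤ n) : (stdDrawing n).IsTriangulated := by
  refine ⟨stdDrawing_isPlane, ?_⟩
  rintro _ ⟨p, hp, rfl⟩
  have e0 : (stdDrawing n).pos ⟨0, by omega⟩ = (-1, 0) :=
    (stdDrawing_pos _).trans (stdPos_zero rfl)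
  have e1 : (stdDrawing n).pos ⟨1, by omega⟩ = (1, 0) :=
    (stdDrawing_pos _).trans (stdPos_one rfl)
  have hH : (0 : ℝ) < (n - 1 : ℕ) := by exact_mod_cast (by omega : 0 < n - 1)
  by_cases hT : p ∈ convexHull ℝ {((-1, 0) : ℝ × ℝ), (1, 0), (0, ((n - 1 : ℕ) : ℝ))}
  swap
  · obtain ⟨h1, h2⟩ := outer_region hn hT
    exact ⟨_, _, _, h1 ▸ h2⟩
  obtain ⟨h1, h2⟩ := (mem_base_triangle hH p).1 hT
  have hx : |p.1| ≤ 1 := by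
    by_contra hc
    have : ((n - 1 : ℕ) : ℝ) * (1 - |p.1|) < 0 := mul_neg_of_pos_of_neg hH (by linarith)
    linarith
  have hy : 0 < p.2 := by
    refine lt_of_le_of_ne h1 fun h => hp ?_
    rw [show p = (p.1, 0) from Prod.ext rfl h.symm]
    exact base_mem_support (by omega) hx
  have ht : 0 < 1 - |p.1| := by
    refine lt_of_le_of_ne (by linarith) fun h => ?_
    rw [← h, mul_zero] at h2
    linarith
  by_cases hB : p.2 < 2 * (1 - |p.1|)
  · have e2 : (stdDrawing n).pos ⟨2, by omega⟩ = (0, 2) :=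
      (stdDrawing_pos _).trans ((stdPos_path le_rfl).trans (by simp))
    have hcr : cross (((1, 0) : ℝ × ℝ) - (-1, 0)) (((0, 2) : ℝ × ℝ) - (-1, 0)) ≠ 0 := by
      rw [cross_base]; norm_num
    obtain ⟨h3, h4⟩ := face_eq_of_region (D := stdDrawing n)
      (a := ⟨0, by omega⟩) (b := ⟨1, by omega⟩) (c := ⟨2, by omega⟩)
      ⟨by simp, by simp⟩ ⟨by simp, by simp⟩
      ⟨by simp, by simp⟩ (convex_openTriangle hcr).isPreconnected
      (base_openTriangle_subset (by omega)) (by rw [e0, e1, e2, frontier_openTriangle hcr])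
      ((mem_base_openTriangle p).2 ⟨hy, hB⟩)
    exact ⟨_, _, _, h3 ▸ h4⟩
  -- The height of the tent through `p`. Its integer part `k` locates the face, and the sign of
  -- `p.1` selects the side.
  set t := p.2 / (1 - |p.1|) with htdef
  have hpt : p.2 = t * (1 - |p.1|) := by rw [htdef]; field_simp
  have ht2 : 2 ≤ t := by
    rw [htdef, le_div_iff₀ ht]
    exact not_lt.1 hB
  have htn : t ≤ (n - 1 : ℕ) := by
    rw [htdef, div_le_iff₀ ht]
    exact h2
  obtain ⟨k, hk1, hk2⟩ : ∃ k : ℕ, (k : ℝ) ≤ t ∧ t < k + 1 :=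
    ⟨⌊t⌋₊, Nat.floor_le (by linarith), Nat.lt_floor_add_one t⟩
  have hk : 2 ≤ k := by
    have : (2 : ℝ) < k + 1 := by linarith
    norm_cast at this
    omega
  have hkn : k ≤ n - 1 := by
    have : (k : ℝ) ≤ (n - 1 : ℕ) := by linarith
    exact_mod_cast this
  -- An integral `t` would put `p` on a spoke.
  have hkt : (k : ℝ) < t := by
    refine lt_of_le_of_ne hk1 fun h => hp ?_
    rw [← h] at hpt
    rw [show p = (p.1, k * (1 - |p.1|)) from Prod.ext rfl hpt]
    exact spoke_mem_support hk (by omega) hx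
  have hkn' : k + 1 < n := by
    have : (k : ℝ) < (n - 1 : ℕ) := by linarith
    norm_cast at this
    omega
  have h3 : k * (1 - |p.1|) < p.2 := by
    rw [hpt]; exact mul_lt_mul_of_pos_right hkt ht
  have h4 : p.2 < (k + 1) * (1 - |p.1|) := by
    rw [hpt]; exact mul_lt_mul_of_pos_right hk2 ht
  have ek : (stdDrawing n).pos ⟨k, by omega⟩ = (0, (k : ℝ)) := stdPos_path hk
  have ek' : (stdDrawing n).pos ⟨k + 1, hkn'⟩ = (0, (k : ℝ) + 1) :=
    (stdDrawing_pos _).trans ((stdPos_path (by dsimp only; omega)).trans (by simp))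
  rcases lt_trichotomy p.1 0 with hx0 | hx0 | hx0
  · have hcr := (cross_left k).trans_ne one_ne_zero
    obtain ⟨h5, h6⟩ := face_eq_of_region (D := stdDrawing n)
      (a := ⟨0, by omega⟩) (b := ⟨k, by omega⟩) (c := ⟨k + 1, hkn'⟩)
      ⟨by simp [Fin.ext_iff]; omega, by simp⟩ ⟨by simp, by simp⟩ ⟨by simp, by simp⟩
      (convex_openTriangle hcr).isPreconnected
      (fun q hq => by
        obtain ⟨q1, q2, q3⟩ := (mem_left_openTriangle k q).1 hq
        exact notMem_support_of_between (by omega) q1.ne q2 q3)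
      (by rw [e0, ek, ek', frontier_openTriangle hcr])
      ((mem_left_openTriangle k p).2 ⟨hx0, h3, h4⟩)
    exact ⟨_, _, _, h5 ▸ h6⟩
  · refine (hp ?_).elim
    rw [hx0, abs_zero, sub_zero, mul_one] at hpt
    rw [show p = (0, t) from Prod.ext hx0 hpt]
    exact path_mem_support hk hkn' hk1 hk2.le
  · have hcr := (cross_right k).trans_ne (neg_ne_zero.2 one_ne_zero)
    obtain ⟨h5, h6⟩ := face_eq_of_region (D := stdDrawing n)
      (a := ⟨1, by omega⟩) (b := ⟨k, by omega⟩) (c := ⟨k + 1, hkn'⟩)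
      ⟨by simp [Fin.ext_iff]; omega, by simp⟩ ⟨by simp, by simp⟩
      ⟨by simp [Fin.ext_iff]; omega, by simp⟩
      (convex_openTriangle hcr).isPreconnected
      (fun q hq => by
        obtain ⟨q1, q2, q3⟩ := (mem_right_openTriangle k q).1 hq
        exact notMem_support_of_between (by omega) q1.ne' q2 q3)
      (by rw [e1, ek, ek', frontier_openTriangle hcr])
      ((mem_right_openTriangle k p).2 ⟨hx0, h3, h4⟩)
    exact ⟨_, _, _, h5 ▸ h6⟩

theorem stdDrawing_hasOuterface (hn : 3 ≤ n) :
    (stdDrawing n).HasOuterface ⟨0, by omega⟩ ⟨1, by omega⟩ ⟨n - 1, by omega⟩ := by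
  have hH : (0 : ℝ) < (n - 1 : ℕ) := by exact_mod_cast (by omega : 0 < n - 1)
  have hp : ((0, -1) : ℝ × ℝ) ∉
      convexHull ℝ {((-1, 0) : ℝ × ℝ), (1, 0), (0, ((n - 1 : ℕ) : ℝ))} := fun h => by
    have := ((mem_base_triangle hH _).1 h).1
    norm_num at this
  obtain ⟨h1, h2⟩ := outer_region hn hp
  -- The point `(0, -1)` is below the base. Were this face bounded, its union with the triangle, the
  -- whole plane, would be too.
  refine ⟨_, ⟨⟨(0, -1), ?_, h1.symm⟩, fun hb => ?_⟩, h2⟩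
  · refine connectedComponentIn_nonempty_iff.1 ?_
    rw [h1]
    exact ⟨_, hp⟩
  · refine NormedSpace.unbounded_univ ℝ (ℝ × ℝ) ?_
    rw [← union_compl_self (convexHull ℝ {((-1, 0) : ℝ × ℝ), (1, 0), (0, ((n - 1 : ℕ) : ℝ))})]
    exact (isBounded_triangle _ _ _).union hb

end edgeJoinPath

theorem mainTheorem10 (n : ℕ) (hn : 4 ≤ n) :
    ∃ G : SimpleGraph (Fin n),
      IsPlanarTriangulation G ∧
      (∀ D : Drawing G, D.IsPlane → n + 2 ≤ D.numSlopes) ∧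
      ∃ a b c : Fin n,
        (∃ D : Drawing G, D.IsTriangulated ∧ D.HasOuterface a b c) ∧
        ∀ D : Drawing G, D.IsPlane → D.HasOuterface a b c → 2 * n - 2 ≤ D.numSlopes :=
  have h3 : 3 ≤ n := by omega
  ⟨edgeJoinPath n, ⟨edgeJoinPath.stdDrawing n, edgeJoinPath.stdDrawing_isTriangulated h3⟩,
    fun _ hD => edgeJoinPath.add_two_le_numSlopes hn hD, _, _, _,
    ⟨edgeJoinPath.stdDrawing n, edgeJoinPath.stdDrawing_isTriangulated h3,
      edgeJoinPath.stdDrawing_hasOuterface h3⟩,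
    fun _ hD hO => edgeJoinPath.two_mul_sub_two_le_numSlopes hn hD hO⟩
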